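/- Let $a,d,k$ be positive integers with $k\ge 2$ or $d=1$. For $n\in\mathbb N$ let $K_n^k$ be the complete balanced $k$-partite $k$-graph: its vertex set is the disjoint union of $k$ classes $V_1,\dots,V_k$ of size $n$, and its hyperedges are all sets of vertices that have exactly one vertex in each class. For each $n$ let $P_n=(E(K_n^k),r_n)$ be a polymatroid, that is, $r_n:2^{E(K_n^k)}\to\mathbb Z$ is monotone and submodular with $r_n(\emptyset)=0$, and suppose that its rank satisfies $r_n(E(K_n^k))\le an$. The closure of $X\subseteq E(K_n^k)$ in $P_n$ is $\{e\in E(K_n^k): r_n(X\cup\{e\})=r_n(X)\}$. Consider the random hypergraph process that adds the hyperedges of $K_n^k$ one at a time in a uniformly random order. Let $G(n,m)$ be the spanning subgraph of $K_n^k$ formed by the first $m$ hyperedges, and let $M_d$ be the least $m$ such that every vertex of $G(n,m)$ has degree at least $d$ (it exists for all sufficiently large $n$). A degree-$d$ extension of a $k$-graph $G$ adds one new vertex $v$ and $d$ distinct new hyperedges, each consisting of $v$ and $k-1$ vertices of $G$. A $k$-partite $d$-tree is a $k$-partite $k$-graph that is isomorphic to one that can be built from $K_d^k$ by a finite (possibly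 empty) sequence of degree-$d$ extensions. Then, asymptotically almost surely, that is, with probability tending to $1$ as $n\to\infty$, the $k$-graph on $V_1\cup\dots\cup V_k$ whose hyperedges form the closure of $E(G(n,M_d))$ in $P_n$ contains a spanning $k$-partite $d$-tree. -/

import Mathlib

open Filter Topology

/-- A `k`-graph (`k`-uniform hypergraph) whose vertices are taken from the type `V`: a finite vertex
set together with a finite collection of `k`-element subsets of it. -/
structure KGraph (k : ℕ) (V : Type*) where
  verts : Finset V
  edges : Finset (Finset V)
  edge_subset : ∀ e ∈ edges, e ⊆ verts
  edge_card : ∀ e ∈ edges, e.card = k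

namespace KGraph

variable {k : ℕ} {V W : Type*} [DecidableEq V]

/-- `G` is `k`-partite: its vertices can be split into `k` classes (here: the fibres of a map
`c : V → Fin k`) such that every edge has exactly one vertex in each class. -/
def IsPartite (G : KGraph k V) : Prop :=
  ∃ c : V → Fin k, ∀ e ∈ G.edges, ∀ i : Fin k, (e.filter (fun v => c v = i)).card = 1

/-- The number of edges of `G` that contain `v`. -/
def degree (G : KGraph k V) (v : V) : ℕ :=
  (G.edges.filter (fun e => v ∈ e)).card

/-- The minimum degree of `G` is at least `d`. -/
def MinDegreeAtLeast (G : KGraph k V) (d : ℕ) : Prop :=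
  ∀ v ∈ G.verts, d ≤ G.degree v

/-- `H` is a spanning sub-hypergraph of `G`. -/
def IsSpanningSubgraph (H G : KGraph k V) : Prop :=
  H.verts = G.verts ∧ H.edges ⊆ G.edges

/-- The `k`-graph on all vertices of `G` whose edges are the edges of `G` that lie in `F`. -/
def restrictEdges (G : KGraph k V) (F : Finset (Finset V)) : KGraph k V where
  verts := G.verts
  edges := G.edges ∩ F
  edge_subset := fun e he => G.edge_subset e (Finset.mem_inter.1 he).1
  edge_card := fun e he => G.edge_card e (Finset.mem_inter.1 he).1

/-- The isomorphic copy of `G` obtained by renaming its vertices along the injection `f`. -/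
def map (f : V ↪ W) (G : KGraph k V) : KGraph k W where
  verts := G.verts.map f
  edges := G.edges.map (Finset.mapEmbedding f).toEmbedding
  edge_subset := by
    intro e he
    obtain ⟨e', he', rfl⟩ := Finset.mem_map.1 he
    exact Finset.map_subset_map.2 (G.edge_subset e' he')
  edge_card := by
    intro e he
    obtain ⟨e', he', rfl⟩ := Finset.mem_map.1 he
    exact (Finset.card_map f).trans (G.edge_card e' he')

/-- `H` arises from `G` by a degree-`d` extension: one new vertex `v` is added, together with `d`
distinct new edges, each consisting of `v` and `k - 1` vertices of `G` (the size `k` of the new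
edges is part of `H` being a `k`-graph). -/
def IsDegreeExtension (d : ℕ) (G H : KGraph k V) : Prop :=
  ∃ v : V, v ∉ G.verts ∧ H.verts = insert v G.verts ∧
    ∃ F : Finset (Finset V), F.card = d ∧ (∀ e ∈ F, v ∈ e ∧ e.erase v ⊆ G.verts) ∧
      H.edges = G.edges ∪ F

end KGraph

/-- The complete balanced `k`-partite `k`-graph `K_n^k`. The vertex `(i, j)` is the `j`-th vertex of
the `i`-th class; the edges are all sets of vertices with exactly one vertex in each class. -/
def completeBalanced (k n : ℕ) : KGraph k (Fin k × Fin n) where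
  verts := Finset.univ
  edges := Finset.univ.filter (fun e => ∀ i : Fin k, (e.filter (fun v => v.1 = i)).card = 1)
  edge_subset := fun e _ => Finset.subset_univ e
  edge_card := by
    intro e he
    have h := (Finset.mem_filter.1 he).2
    have h2 := Finset.card_eq_sum_card_fiberwise (f := fun v : Fin k × Fin n => v.1) (s := e)
      (t := Finset.univ) (fun _ _ => Finset.mem_coe.2 (Finset.mem_univ _))
    rw [h2, Finset.sum_congr rfl (fun i _ => h i)]
    simp

/-- The `k`-graphs that can be built from an isomorphic copy of `K_d^k` by a finite sequence of
degree-`d` extensions. -/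
inductive IsBuiltByExtensions {k : ℕ} {V : Type*} [DecidableEq V] (d : ℕ) : KGraph k V → Prop
  | base (f : Fin k × Fin d ↪ V) : IsBuiltByExtensions d ((completeBalanced k d).map f)
  | extend {G H : KGraph k V} : IsBuiltByExtensions d G → G.IsDegreeExtension d H →
      IsBuiltByExtensions d H

/-- A `k`-partite `d`-tree: a `k`-partite `k`-graph that can be built, up to isomorphism, from
`K_d^k` by a finite sequence of degree-`d` extensions. -/
def IsPartiteTree {k : ℕ} {V : Type*} [DecidableEq V] (d : ℕ) (T : KGraph k V) : Prop :=
  T.IsPartite ∧ IsBuiltByExtensions d T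

/-- A polymatroid on the finite ground set `E`: an integer-valued rank function on the subsets of
`E` that vanishes on the empty set, is monotone and is submodular. (Values of `r` on sets that are
not subsets of `E` are irrelevant.) -/
structure Polymatroid {α : Type*} [DecidableEq α] (E : Finset α) where
  r : Finset α → ℤ
  r_empty : r ∅ = 0
  r_mono : ∀ X Y : Finset α, X ⊆ Y → Y ⊆ E → r X ≤ r Y
  r_submod : ∀ X Y : Finset α, X ⊆ E → Y ⊆ E → r (X ∩ Y) + r (X ∪ Y) ≤ r X + r Y

namespace Polymatroid

variable {α : Type*} [DecidableEq α] {E : Finset α}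

/-- The rank `r(E)` of the polymatroid. -/
def rank (P : Polymatroid E) : ℤ := P.r E

/-- The closure `{e ∈ E : r(X + e) = r(X)}` of `X ⊆ E`. -/
def closure (P : Polymatroid E) (X : Finset α) : Finset α :=
  E.filter (fun e => P.r (insert e X) = P.r X)

end Polymatroid

/-- The orderings of the edges of `K_n^k`. The random hypergraph process adds the edges one at a
time in a uniformly random order. -/
abbrev EdgeOrdering (k n : ℕ) : Type :=
  Fin (completeBalanced k n).edges.card ≃ (completeBalanced k n).edges

instance instNonemptyEdgeOrdering (k n : ℕ) : Nonempty (EdgeOrdering k n) :=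
  ⟨(completeBalanced k n).edges.equivFin.symm⟩

/-- The first `m` edges in the ordering `ω`. -/
def firstEdges {k n : ℕ} (ω : EdgeOrdering k n) (m : ℕ) : Finset (Finset (Fin k × Fin n)) :=
  (Finset.univ.filter (fun i : Fin (completeBalanced k n).edges.card => (i : ℕ) < m)).image
    (fun i => (ω i : Finset (Fin k × Fin n)))

/-- `G(n, m)`, as the state after `m` steps of the random hypergraph process: for `m ≤ n ^ k` and a
uniformly random `ω` it is uniformly distributed over the spanning subgraphs of `K_n^k` with exactly
`m` edges. -/
def randomGraph {k n : ℕ} (ω : EdgeOrdering k n) (m : ℕ) : KGraph k (Fin k × Fin n) :=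
  (completeBalanced k n).restrictEdges (firstEdges ω m)

/-- The random variable `M_d`: the least `m` for which `G(n, m)` has minimum degree at least `d`. -/
noncomputable def hittingTime {k n : ℕ} (d : ℕ) (ω : EdgeOrdering k n) : ℕ :=
  sInf {m : ℕ | (randomGraph ω m).MinDegreeAtLeast d}

/-- The graph of the closure of (the edge set of) `G` in the polymatroid `P` on the edge set of
`K_n^k`. -/
def closureGraph {k n : ℕ} (P : Polymatroid (completeBalanced k n).edges)
    (G : KGraph k (Fin k × Fin n)) : KGraph k (Fin k × Fin n) :=
  (completeBalanced k n).restrictEdges (P.closure G.edges)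

/-- The probability of a property of a uniformly random ordering of the edges of `K_n^k`. -/
noncomputable def orderingProb (k n : ℕ) (A : EdgeOrdering k n → Prop) : ENNReal :=
  (PMF.uniformOfFintype (EdgeOrdering k n)).toOuterMeasure {ω | A ω}

/-!
The random ordering is compared with independent labels: every edge receives label `0`, `1` or `2`,
and listing the edges by increasing label, in uniformly random order among equal labels, gives a
uniformly random ordering (`uniformProb_le_labelProb`). Let `R₀ ⊆ R₁` be the sets of edges with label
at most `0` and at most `1`, of densities `(3/4) log n / n ^ (k - 1)` and `4 log n / n ^ (k - 1)`. With
high probability `R₀` leaves a vertex uncovered (`labelProb_cover`) while `R₁` has minimum degree `d`,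
so that the edge set of the graph at the hitting time lies between `R₀` and `R₁`.

The rank can increase only `a n` times, so the closure of the first `(1/4) n log n` edges misses on
average only `O(1 / log n)` of all edges (`sum_card_sdiff_closure_initialSet_le`). As `R₀` typically
has more than `(1/4) n log n` edges, the closure at the hitting time is almost complete, and by
averaging over shifts of `K_d^k` it contains a copy of `K_d^k` to which all but `δ n` vertices can be
attached directly (`exists_core`).

Take a maximal tree that contains this copy, and let `X` be the set of vertices it misses, so
`|X| < ⌈δ n⌉`. If `X` is nonempty, then in the graph at the hitting time every vertex of `X` has
fewer than `d` edges that meet `X` only in it, although its degree is at least `d`. Hence `R₀` has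
at most `d |X|` edges that meet `X` in exactly one vertex, and `X` is covered by edges of `R₁` with at least two vertices in `X`. Such a set
`X` is called stuck (`IsStuck`). A first moment computation excludes stuck sets of size below `δ n`:
for `|X| = s` there are about `(n / s) ^ s` choices, the cover costs a factor of about
`(s / n) ^ (s / 2)`, and the lack of edges of `R₀` costs about `n ^ (- 3 s / 4)`; the product is at most
`(C n ^ (- 1 / 10)) ^ s` (`choose_mul_stuck_bound_le`). All these probabilities are bounded by
exponential moments, which factorize over the independent labels (`labelProb_le_prod`).

For `k = d = 1` the hitting time is reached only when all edges are present.
-/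

/-! ### Random labels and random orderings -/

/-- The probability of the event `A` under the uniform distribution on the finite type `Ω`. -/
noncomputable def uniformProb {Ω : Type*} [Fintype Ω] (A : Set Ω) : ℝ :=
  (∑ x, A.indicator (fun _ => (1 : ℝ)) x) / Fintype.card Ω

/-- The probability of the event `B` when every element of `α` receives, independently, the label
`c` with probability `w c`. -/
noncomputable def labelProb {α : Type*} [Fintype α] [DecidableEq α] {C : Type*} [Fintype C]
    (w : C → ℝ) (B : Set (α → C)) : ℝ :=
  ∑ f : α → C, B.indicator (fun f => ∏ e, w (f e)) f

section uniformProb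

variable {Ω : Type*} [Fintype Ω]

lemma uniformProb_nonneg (A : Set Ω) : 0 ≤ uniformProb A :=
  div_nonneg (Finset.sum_nonneg fun _ _ => Set.indicator_nonneg (fun _ _ => zero_le_one) _)
    (Nat.cast_nonneg _)

lemma uniformProb_mono {A B : Set Ω} (h : A ⊆ B) : uniformProb A ≤ uniformProb B := by
  unfold uniformProb
  gcongr

lemma uniformProb_union_le (A B : Set Ω) :
    uniformProb (A ∪ B) ≤ uniformProb A + uniformProb B := by
  unfold uniformProb
  rw [← add_div, ← Finset.sum_add_distrib]
  gcongr with x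
  by_cases h1 : x ∈ A <;> by_cases h2 : x ∈ B <;> simp [h1, h2]

lemma uniformProb_compl [Nonempty Ω] (A : Set Ω) : uniformProb Aᶜ = 1 - uniformProb A := by
  have h0 : (Fintype.card Ω : ℝ) ≠ 0 := by exact_mod_cast Fintype.card_ne_zero
  unfold uniformProb
  rw [eq_sub_iff_add_eq, ← add_div, ← Finset.sum_add_distrib, div_eq_one_iff_eq h0]
  rw [Finset.sum_congr rfl (g := fun _ => (1 : ℝ))]
  · simp
  · intro x _
    by_cases h : x ∈ A <;> simp [h]

/-- Markov's inequality for the uniform distribution. -/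
lemma uniformProb_le_of_sum_le (Z : Ω → ℝ) (hZ : ∀ x, 0 ≤ Z x) {t S : ℝ} (ht : 0 < t)
    (hS : ∑ x, Z x ≤ S * Fintype.card Ω) (hS0 : 0 ≤ S) : uniformProb {x | t ≤ Z x} ≤ S / t := by
  unfold uniformProb
  rcases (Nat.cast_nonneg (α := ℝ) (Fintype.card Ω)).eq_or_lt with h0 | h0
  · rw [← h0, div_zero]
    positivity
  rw [div_le_div_iff₀ h0 ht]
  refine le_trans ?_ hS
  rw [Finset.sum_mul]
  refine Finset.sum_le_sum fun x _ => ?_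
  by_cases h : t ≤ Z x
  · simp [h]
  · simp [h, hZ x]

/-- The probability mass function of the uniform distribution gives the same probabilities. -/
lemma uniformOfFintype_toOuterMeasure [Nonempty Ω] (A : Set Ω) :
    (PMF.uniformOfFintype Ω).toOuterMeasure A = ENNReal.ofReal (uniformProb A) := by
  classical
  rw [PMF.toOuterMeasure_uniformOfFintype_apply, uniformProb,
    ENNReal.ofReal_div_of_pos (by exact_mod_cast Fintype.card_pos), ENNReal.ofReal_natCast]
  congr 1
  have : (∑ x, A.indicator (fun _ => (1 : ℝ)) x) = (Fintype.card A : ℝ) := by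
    rw [Finset.sum_indicator_eq_sum_filter]
    simp [Fintype.card_subtype]
  rw [this, ENNReal.ofReal_natCast]

end uniformProb

section labelProb

variable {α : Type*} [Fintype α] [DecidableEq α] {C : Type*} [Fintype C] {w : C → ℝ}

lemma labelProb_mono (hw : ∀ c, 0 ≤ w c) {A B : Set (α → C)} (h : A ⊆ B) :
    labelProb w A ≤ labelProb w B :=
  Finset.sum_le_sum fun _ _ => Set.indicator_le_indicator_of_subset h
    (fun _ => Finset.prod_nonneg fun _ _ => hw _) _

lemma labelProb_union_le (hw : ∀ c, 0 ≤ w c) (A B : Set (α → C)) :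
    labelProb w (A ∪ B) ≤ labelProb w A + labelProb w B := by
  unfold labelProb
  rw [← Finset.sum_add_distrib]
  refine Finset.sum_le_sum fun f _ => ?_
  have : 0 ≤ ∏ e, w (f e) := Finset.prod_nonneg fun _ _ => hw _
  by_cases h1 : f ∈ A <;> by_cases h2 : f ∈ B <;> simp [h1, h2, this]

lemma labelProb_biUnion_le (hw : ∀ c, 0 ≤ w c) {ι : Type*} (s : Finset ι)
    (A : ι → Set (α → C)) :
    labelProb w (⋃ i ∈ s, A i) ≤ ∑ i ∈ s, labelProb w (A i) := by
  classical
  induction s using Finset.induction_on with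
  | empty => simp [labelProb]
  | insert a s ha ih =>
    rw [Finset.sum_insert ha, Finset.set_biUnion_insert]
    exact (labelProb_union_le hw _ _).trans (by gcongr)

/-- By independence, the expectation of a product of functions of the single labels is the product
of their expectations. -/
lemma sum_prod_label (g : α → C → ℝ) :
    ∑ f : α → C, (∏ e, w (f e)) * ∏ e, g e (f e) = ∏ e, ∑ c, w c * g e c := by
  rw [Finset.prod_univ_sum, Fintype.piFinset_univ]
  simp_rw [Finset.prod_mul_distrib]

/-- The exponential moment method: an event whose indicator is at most a constant times a product
of functions of the single labels. -/
lemma labelProb_le_prod (hw : ∀ c, 0 ≤ w c) (B : Set (α → C)) (g : α → C → ℝ) (K : ℝ)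
    (hg : ∀ e c, 0 ≤ g e c) (hK : 0 ≤ K) (hB : ∀ f ∈ B, 1 ≤ K * ∏ e, g e (f e)) :
    labelProb w B ≤ K * ∏ e, ∑ c, w c * g e c := by
  rw [← sum_prod_label, Finset.mul_sum]
  refine Finset.sum_le_sum fun f _ => ?_
  have h0 : 0 ≤ ∏ e, w (f e) := Finset.prod_nonneg fun _ _ => hw _
  by_cases h : f ∈ B
  · rw [Set.indicator_of_mem h, mul_left_comm]
    exact le_mul_of_one_le_right h0 (hB f h)
  · rw [Set.indicator_of_notMem h]
    exact mul_nonneg hK (mul_nonneg h0 (Finset.prod_nonneg fun _ _ => hg _ _))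

/-- Sorting random labels produces a uniformly random ordering. Hence an event `A` of orderings is
at most as likely as an event `B` of independent labels that holds whenever `A` holds for some
ordering that lists the elements by increasing label. -/
lemma uniformProb_le_labelProb [LinearOrder C] (hw : ∀ c, 0 ≤ w c) (hw1 : ∑ c, w c = 1) {M : ℕ}
    (ω₀ : Fin M ≃ α) (A : Set (Fin M ≃ α)) (B : Set (α → C))
    (hAB : ∀ (ω : Fin M ≃ α) (f : α → C), Monotone (f ∘ ω) → ω ∈ A → f ∈ B) :
    uniformProb A ≤ labelProb w B := by
  have hsort : ∀ f : α → C, ∃ ω : Fin M ≃ α, Monotone (f ∘ ω) := fun f =>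
    ⟨(Tuple.sort (f ∘ ω₀)).trans ω₀, by
      have := Tuple.monotone_sort (f ∘ ω₀)
      simpa [Function.comp_assoc] using this⟩
  choose s hs using hsort
  have hcard : Fintype.card (Fin M ≃ α) = Fintype.card (Equiv.Perm α) :=
    Fintype.card_congr (ω₀.equivCongr (Equiv.refl α))
  have hpos : (0 : ℝ) < Fintype.card (Equiv.Perm α) := by exact_mod_cast Fintype.card_pos
  have hperm : ∀ σ : Equiv.Perm α, labelProb w B =
      ∑ f : α → C, B.indicator (fun _ => (1 : ℝ)) (f ∘ σ) * ∏ e, w (f e) := by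
    intro σ
    unfold labelProb
    rw [← (σ.symm.arrowCongr (Equiv.refl C)).sum_comp]
    refine Finset.sum_congr rfl fun f _ => ?_
    have h1 : (σ.symm.arrowCongr (Equiv.refl C)) f = f ∘ σ := by
      ext e; simp [Equiv.arrowCongr]
    have h2 : ∏ e, w ((f ∘ σ) e) = ∏ e, w (f e) := Equiv.prod_comp σ (fun e => w (f e))
    rw [h1]
    by_cases h : f ∘ σ ∈ B
    · rw [Set.indicator_of_mem h, Set.indicator_of_mem h, one_mul, h2]
    · rw [Set.indicator_of_notMem h, Set.indicator_of_notMem h, zero_mul]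
  have hW : ∑ f : α → C, ∏ e, w (f e) = 1 := by
    have := sum_prod_label (α := α) (w := w) (fun _ _ => 1)
    simpa [hw1] using this
  unfold uniformProb
  rw [hcard, div_le_iff₀ hpos]
  calc ∑ ω, A.indicator (fun _ => (1 : ℝ)) ω
      = ∑ f : α → C, (∏ e, w (f e)) * ∑ ω, A.indicator (fun _ => (1 : ℝ)) ω := by
        rw [← Finset.sum_mul, hW, one_mul]
    _ ≤ ∑ f : α → C, (∏ e, w (f e)) *
          ∑ σ : Equiv.Perm α, B.indicator (fun _ => (1 : ℝ)) (f ∘ σ) := by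
        refine Finset.sum_le_sum fun f _ => mul_le_mul_of_nonneg_left ?_
          (Finset.prod_nonneg fun _ _ => hw _)
        -- `σ ↦ σ⁻¹ ∘ s f` runs over all orderings, and `f ∘ σ` is increasing along `σ⁻¹ ∘ s f`.
        let Φ : Equiv.Perm α ≃ (Fin M ≃ α) :=
          { toFun := fun σ => (s f).trans σ.symm
            invFun := fun ω => ω.symm.trans (s f)
            left_inv := fun σ => by ext; simp
            right_inv := fun ω => by ext; simp }
        rw [← Φ.sum_comp]
        refine Finset.sum_le_sum fun σ _ => ?_
        by_cases h : Φ σ ∈ A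
        · have : f ∘ σ ∈ B := hAB (Φ σ) _ (by
            have : (f ∘ σ) ∘ (Φ σ) = f ∘ (s f) := by
              ext i; simp [Φ]
            rw [this]; exact hs f) h
          rw [Set.indicator_of_mem h, Set.indicator_of_mem this]
        · rw [Set.indicator_of_notMem h]
          exact Set.indicator_nonneg (fun _ _ => zero_le_one) _
    _ = ∑ σ : Equiv.Perm α, labelProb w B := by
        simp_rw [Finset.mul_sum]
        rw [Finset.sum_comm]
        refine Finset.sum_congr rfl fun σ _ => ?_
        rw [hperm σ]
        exact Finset.sum_congr rfl fun f _ => mul_comm _ _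
    _ = labelProb w B * Fintype.card (Equiv.Perm α) := by
        simp [mul_comm]

end labelProb

/-! ### The closure of an initial part of a random ordering -/

namespace Polymatroid

variable {α : Type*} [DecidableEq α] {E : Finset α}

lemma r_insert_mono (P : Polymatroid E) {X Y : Finset α} (hXY : X ⊆ Y) (hY : Y ⊆ E) {e : α}
    (he : e ∈ E) (h : P.r (insert e X) = P.r X) : P.r (insert e Y) = P.r Y := by
  have hX := hXY.trans hY
  have hs := P.r_submod (insert e X) Y (Finset.insert_subset he hX) hY
  have h1 : insert e X ∪ Y = insert e Y := by
    rw [Finset.insert_union, Finset.union_eq_right.2 hXY]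
  have h2 : P.r X ≤ P.r (insert e X ∩ Y) :=
    P.r_mono _ _ (Finset.subset_inter (Finset.subset_insert _ _) hXY)
      (Finset.inter_subset_right.trans hY)
  have h3 := P.r_mono _ _ (Finset.subset_insert e Y) (Finset.insert_subset he hY)
  rw [h1] at hs
  omega

lemma closure_mono (P : Polymatroid E) {X Y : Finset α} (hXY : X ⊆ Y) (hY : Y ⊆ E) :
    P.closure X ⊆ P.closure Y := by
  intro e he
  obtain ⟨heE, h⟩ := Finset.mem_filter.1 he
  exact Finset.mem_filter.2 ⟨heE, P.r_insert_mono hXY hY heE h⟩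

lemma subset_closure (P : Polymatroid E) {X : Finset α} (hX : X ⊆ E) : X ⊆ P.closure X :=
  fun e he => Finset.mem_filter.2 ⟨hX he, by rw [Finset.insert_eq_self.2 he]⟩

end Polymatroid

section initialSet

variable {α : Type*} [DecidableEq α] {E : Finset α} {M : ℕ}

/-- The set of the first `m` elements in the ordering `ω` of `E`. -/
def initialSet (ω : Fin M ≃ E) (m : ℕ) : Finset α :=
  (Finset.univ.filter (fun i : Fin M => (i : ℕ) < m)).image (fun i => (ω i : α))

lemma mem_initialSet {ω : Fin M ≃ E} {m : ℕ} {e : α} :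
    e ∈ initialSet ω m ↔ ∃ i : Fin M, (i : ℕ) < m ∧ (ω i : α) = e := by
  simp [initialSet]

lemma apply_mem_initialSet {ω : Fin M ≃ E} {m : ℕ} {i : Fin M} :
    (ω i : α) ∈ initialSet ω m ↔ (i : ℕ) < m := by
  rw [mem_initialSet]
  constructor
  · rintro ⟨j, hj, h⟩
    rwa [← ω.injective (Subtype.ext h)]
  · exact fun h => ⟨i, h, rfl⟩

lemma initialSet_subset (ω : Fin M ≃ E) (m : ℕ) : initialSet ω m ⊆ E := by
  intro e he
  obtain ⟨i, -, rfl⟩ := mem_initialSet.1 he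
  exact (ω i).2

lemma initialSet_mono (ω : Fin M ≃ E) : Monotone (initialSet ω) := by
  intro m m' h e he
  obtain ⟨i, hi, rfl⟩ := mem_initialSet.1 he
  exact apply_mem_initialSet.2 (hi.trans_le h)

lemma card_initialSet_le (ω : Fin M ≃ E) (m : ℕ) : (initialSet ω m).card ≤ m := by
  refine Finset.card_image_le.trans ?_
  have : (Finset.univ.filter (fun i : Fin M => (i : ℕ) < m)).map Fin.valEmbedding
      ⊆ Finset.range m := by
    intro x hx
    simp only [Finset.mem_map, Finset.mem_filter] at hx
    obtain ⟨i, ⟨-, hi⟩, rfl⟩ := hx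
    simpa using hi
  simpa using Finset.card_le_card this

lemma initialSet_succ (ω : Fin M ≃ E) (i : Fin M) :
    initialSet ω (i + 1) = insert (ω i : α) (initialSet ω i) := by
  ext e
  simp only [Finset.mem_insert, mem_initialSet]
  constructor
  · rintro ⟨j, hj, rfl⟩
    rcases (Nat.lt_succ_iff.1 hj).lt_or_eq with h | h
    · exact Or.inr ⟨j, h, rfl⟩
    · exact Or.inl (by rw [Fin.ext h])
  · rintro (rfl | ⟨j, hj, rfl⟩)
    · exact ⟨i, Nat.lt_succ_self _, rfl⟩
    · exact ⟨j, hj.trans (Nat.lt_succ_self _), rfl⟩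

lemma initialSet_swap (ω : Fin M ≃ E) {i j : Fin M} (hij : i ≤ j) :
    initialSet ((Equiv.swap i j).trans ω) i = initialSet ω i := by
  ext e
  simp only [mem_initialSet]
  refine exists_congr fun l => and_congr_right fun hl => ?_
  have h1 : l ≠ i := fun h => by subst h; exact lt_irrefl _ hl
  have h2 : l ≠ j := fun h => by subst h; exact absurd hij (not_le.2 hl)
  rw [Equiv.trans_apply, Equiv.swap_apply_of_ne_of_ne h1 h2]

variable (P : Polymatroid E)

/-- The next element of a random ordering is a uniformly random element outside the present initial
part, so it leaves the closure with probability at least the proportion of elements missing from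
the closure. -/
lemma sum_card_sdiff_closure_le (i : Fin M) :
    ∑ ω : Fin M ≃ E, (E \ P.closure (initialSet ω i)).card ≤
      M * ∑ ω : Fin M ≃ E, if (ω i : α) ∈ P.closure (initialSet ω i) then 0 else 1 := by
  have h1 : ∀ ω : Fin M ≃ E, (E \ P.closure (initialSet ω i)).card =
      ∑ j : Fin M, if (ω j : α) ∈ P.closure (initialSet ω i) then 0 else 1 := by
    intro ω
    rw [ω.sum_comp (fun e : E => if (e : α) ∈ P.closure (initialSet ω i) then 0 else 1),
      Finset.sum_coe_sort E (fun e => if e ∈ P.closure (initialSet ω i) then 0 else 1),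
      Finset.card_eq_sum_ones, Finset.sdiff_eq_filter, Finset.sum_filter]
    exact Finset.sum_congr rfl fun e _ => by split_ifs <;> simp_all
  simp_rw [h1]
  rw [Finset.sum_comm]
  calc _ ≤ ∑ _j : Fin M,
        ∑ ω : Fin M ≃ E, if (ω i : α) ∈ P.closure (initialSet ω i) then 0 else 1 := by
        refine Finset.sum_le_sum fun j _ => ?_
        rcases lt_or_ge j i with hj | hj
        · refine (Finset.sum_eq_zero fun ω _ => ?_).trans_le (Nat.zero_le _)
          rw [if_pos]
          exact P.subset_closure (initialSet_subset ω _) (apply_mem_initialSet.2 hj)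
        · let Ψ : (Fin M ≃ E) ≃ (Fin M ≃ E) :=
            { toFun := fun ω => (Equiv.swap i j).trans ω
              invFun := fun ω => (Equiv.swap i j).trans ω
              left_inv := fun ω => by ext; simp
              right_inv := fun ω => by ext; simp }
          rw [← Ψ.sum_comp]
          refine le_of_eq (Finset.sum_congr rfl fun ω _ => ?_)
          have : Ψ ω = (Equiv.swap i j).trans ω := rfl
          rw [this, initialSet_swap ω hj, Equiv.trans_apply, Equiv.swap_apply_right]
    _ = _ := by simp

/-- Along an ordering the rank increases whenever the next element lies outside the closure, hence
this happens at most `r(E)` times. -/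
lemma sum_notMem_closure_le_rank (ω : Fin M ≃ E) {m : ℕ} (hm : m ≤ M) :
    (∑ i : Fin m, if (ω (Fin.castLE hm i) : α) ∈
      P.closure (initialSet ω i) then (0 : ℤ) else 1) ≤ P.rank := by
  have hstep : ∀ i : Fin m, (if (ω (Fin.castLE hm i) : α) ∈
      P.closure (initialSet ω i) then (0 : ℤ) else 1) ≤
      P.r (initialSet ω (i + 1)) - P.r (initialSet ω i) := by
    intro i
    have h1 : initialSet ω (i + 1) = insert (ω (Fin.castLE hm i) : α) (initialSet ω i) :=
      initialSet_succ ω (Fin.castLE hm i)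
    have h2 := P.r_mono _ _ (initialSet_mono ω (Nat.le_add_right (i : ℕ) 1)) (initialSet_subset ω _)
    split_ifs with h
    · omega
    · have h3 : P.r (initialSet ω (i + 1)) ≠ P.r (initialSet ω i) := fun h3 => h
        (Finset.mem_filter.2 ⟨(ω (Fin.castLE hm i)).2, h1 ▸ h3⟩)
      omega
  refine (Finset.sum_le_sum fun i _ => hstep i).trans ?_
  rw [Fin.sum_univ_eq_sum_range (fun i => P.r (initialSet ω (i + 1)) - P.r (initialSet ω i)),
    Finset.sum_range_sub (fun i => P.r (initialSet ω i))]
  have h0 : initialSet ω 0 = ∅ := by simp [initialSet]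
  rw [h0, P.r_empty, sub_zero]
  exact P.r_mono _ _ (initialSet_subset ω m) subset_rfl

/-- On average, the closure of the first `m` elements of a random ordering of `M` elements misses at
most `r(E) M / m` elements. -/
lemma sum_card_sdiff_closure_initialSet_le {m : ℕ} (hm : m ≤ M) :
    (m : ℝ) * ∑ ω : Fin M ≃ E, ((E \ P.closure (initialSet ω m)).card : ℝ) ≤
      P.rank * M * Fintype.card (Fin M ≃ E) := by
  have h1 : ∀ i : Fin m, ∑ ω : Fin M ≃ E, ((E \ P.closure (initialSet ω m)).card : ℝ) ≤
      M * ∑ ω : Fin M ≃ E, if (ω (Fin.castLE hm i) : α) ∈ P.closure (initialSet ω i)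
        then (0 : ℝ) else 1 := by
    intro i
    have h2 := sum_card_sdiff_closure_le P (Fin.castLE hm i)
    have h3 : ∑ ω : Fin M ≃ E, ((E \ P.closure (initialSet ω m)).card : ℝ) ≤
        ∑ ω : Fin M ≃ E, ((E \ P.closure (initialSet ω (Fin.castLE hm i))).card : ℝ) := by
      refine Finset.sum_le_sum fun ω _ => ?_
      exact_mod_cast Finset.card_le_card (Finset.sdiff_subset_sdiff subset_rfl
        (P.closure_mono (initialSet_mono ω i.2.le) (initialSet_subset ω m)))
    refine h3.trans ?_
    exact_mod_cast h2
  calc _ = ∑ _i : Fin m, ∑ ω : Fin M ≃ E, ((E \ P.closure (initialSet ω m)).card : ℝ) := by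
        simp
    _ ≤ ∑ i : Fin m, (M : ℝ) * ∑ ω : Fin M ≃ E,
          if (ω (Fin.castLE hm i) : α) ∈ P.closure (initialSet ω i) then (0 : ℝ) else 1 :=
        Finset.sum_le_sum fun i _ => h1 i
    _ = M * ∑ ω : Fin M ≃ E, ∑ i : Fin m,
          if (ω (Fin.castLE hm i) : α) ∈ P.closure (initialSet ω i) then (0 : ℝ) else 1 := by
        rw [← Finset.mul_sum, Finset.sum_comm]
    _ ≤ M * ∑ _ω : Fin M ≃ E, (P.rank : ℝ) := by
        gcongr with ω
        exact_mod_cast sum_notMem_closure_le_rank P ω hm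
    _ = _ := by
        rw [Finset.sum_const, nsmul_eq_mul, Finset.card_univ]; ring

end initialSet

/-! ### Counting edges of the complete balanced `k`-partite `k`-graph -/

section edgeOf

variable {k n : ℕ}

/-- The edge of `K_n^k` whose vertex in the `i`-th class is the `g i`-th one. -/
def edgeOf (g : Fin k → Fin n) : Finset (Fin k × Fin n) :=
  Finset.univ.image (fun i => (i, g i))

lemma mem_edgeOf {g : Fin k → Fin n} {v : Fin k × Fin n} : v ∈ edgeOf g ↔ g v.1 = v.2 := by
  obtain ⟨i, x⟩ := v
  simp [edgeOf]

lemma edgeOf_injective : Function.Injective (edgeOf (k := k) (n := n)) := by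
  intro g h hgh
  funext i
  have : (i, g i) ∈ edgeOf h := hgh ▸ mem_edgeOf.2 rfl
  exact (mem_edgeOf.1 this).symm

lemma edgeOf_mem (g : Fin k → Fin n) : edgeOf g ∈ (completeBalanced k n).edges := by
  refine Finset.mem_filter.2 ⟨Finset.mem_univ _, fun i => ?_⟩
  rw [Finset.card_eq_one]
  refine ⟨(i, g i), ?_⟩
  ext ⟨j, x⟩
  simp only [Finset.mem_filter, mem_edgeOf, Finset.mem_singleton, Prod.mk.injEq]
  constructor
  · rintro ⟨rfl, rfl⟩; exact ⟨rfl, rfl⟩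
  · rintro ⟨rfl, rfl⟩; exact ⟨rfl, rfl⟩

lemma exists_edgeOf_eq {e : Finset (Fin k × Fin n)} (he : e ∈ (completeBalanced k n).edges) :
    ∃ g, edgeOf g = e := by
  have h := (Finset.mem_filter.1 he).2
  have h1 : ∀ i : Fin k, ∃ x : Fin n, e.filter (fun v => v.1 = i) = {(i, x)} := by
    intro i
    obtain ⟨⟨j, x⟩, hv⟩ := Finset.card_eq_one.1 (h i)
    have : (j, x) ∈ e.filter (fun v => v.1 = i) := hv ▸ Finset.mem_singleton_self _
    obtain rfl : j = i := (Finset.mem_filter.1 this).2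
    exact ⟨x, hv⟩
  choose g hg using h1
  refine ⟨g, ?_⟩
  ext ⟨i, x⟩
  have : (i, x) ∈ e ↔ (i, x) ∈ e.filter (fun v => v.1 = i) := by simp
  rw [this, hg i, mem_edgeOf]
  simp [eq_comm]

lemma edges_eq_image :
    (completeBalanced k n).edges = Finset.univ.image (edgeOf (k := k) (n := n)) := by
  ext e
  rw [Finset.mem_image]
  constructor
  · intro he
    obtain ⟨g, hg⟩ := exists_edgeOf_eq he
    exact ⟨g, Finset.mem_univ _, hg⟩
  · rintro ⟨g, -, rfl⟩
    exact edgeOf_mem g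

lemma sum_edges {A : Type*} [AddCommMonoid A] (F : Finset (Fin k × Fin n) → A) :
    ∑ e ∈ (completeBalanced k n).edges, F e = ∑ g : Fin k → Fin n, F (edgeOf g) := by
  rw [edges_eq_image, Finset.sum_image (fun _ _ _ _ h => edgeOf_injective h)]

lemma card_filter_edges (p : Finset (Fin k × Fin n) → Prop) [DecidablePred p] :
    ((completeBalanced k n).edges.filter p).card =
      (Finset.univ.filter (fun g : Fin k → Fin n => p (edgeOf g))).card := by
  rw [Finset.card_filter, sum_edges, Finset.card_filter]

lemma card_edges : (completeBalanced k n).edges.card = n ^ k := by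
  rw [edges_eq_image, Finset.card_image_of_injective _ edgeOf_injective]
  simp

lemma card_apply_mem (i : Fin k) (S : Finset (Fin n)) :
    (Finset.univ.filter (fun g : Fin k → Fin n => g i ∈ S)).card = S.card * n ^ (k - 1) := by
  classical
  have h : Finset.univ.filter (fun g : Fin k → Fin n => g i ∈ S) =
      Fintype.piFinset (fun j => if j = i then S else Finset.univ) := by
    ext g
    simp only [Finset.mem_filter, Finset.mem_univ, true_and, Fintype.mem_piFinset]
    constructor
    · intro hg j
      split_ifs with hj
      · rwa [hj]
      · exact Finset.mem_univ _
    · intro hg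
      simpa using hg i
  rw [h, Fintype.card_piFinset, ← Finset.mul_prod_erase _ _ (Finset.mem_univ i), if_pos rfl]
  congr 1
  rw [Finset.prod_congr rfl (g := fun _ => n)]
  · simp
  · intro j hj
    rw [if_neg (Finset.ne_of_mem_erase hj)]
    simp

/-- The number of edges of `K_n^k` that meet a given subset of one class. -/
lemma card_edges_meeting (i : Fin k) (S : Finset (Fin n)) :
    ((completeBalanced k n).edges.filter (fun e => ∃ x ∈ S, (i, x) ∈ e)).card =
      S.card * n ^ (k - 1) := by
  rw [card_filter_edges, ← card_apply_mem i S]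
  congr 1
  ext g
  simp [mem_edgeOf]

lemma card_edges_containing (v : Fin k × Fin n) :
    ((completeBalanced k n).edges.filter (fun e => v ∈ e)).card = n ^ (k - 1) := by
  have := card_edges_meeting v.1 {v.2}
  simpa using this

lemma card_edgeOf_inter (g : Fin k → Fin n) (X : Finset (Fin k × Fin n)) :
    (edgeOf g ∩ X).card = (Finset.univ.filter (fun i => (i, g i) ∈ X)).card := by
  have : edgeOf g ∩ X = (Finset.univ.filter (fun i => (i, g i) ∈ X)).image (fun i => (i, g i)) := by
    ext ⟨i, x⟩
    simp only [Finset.mem_inter, mem_edgeOf, Finset.mem_image, Finset.mem_filter, Finset.mem_univ,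
      true_and, Prod.mk.injEq]
    constructor
    · rintro ⟨rfl, h⟩; exact ⟨i, h, rfl, rfl⟩
    · rintro ⟨j, h, rfl, rfl⟩; exact ⟨rfl, h⟩
  rw [this, Finset.card_image_of_injective]
  intro i j h
  exact (Prod.mk.inj h).1

/-- The number of edges of `K_n^k` with exactly one vertex in `X` is at least
`|X| (n - |X|) ^ (k - 1)`. -/
lemma card_inter_eq_one_ge (X : Finset (Fin k × Fin n)) :
    X.card * (n - X.card) ^ (k - 1) ≤
      ((completeBalanced k n).edges.filter (fun e => (e ∩ X).card = 1)).card := by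
  classical
  let Q : Fin k × Fin n → Finset (Fin k → Fin n) := fun v =>
    Fintype.piFinset (fun j => if j = v.1 then {v.2} else
      Finset.univ.filter (fun y => (j, y) ∉ X))
  have hQ : ∀ v g, g ∈ Q v → g v.1 = v.2 ∧ ∀ j, j ≠ v.1 → (j, g j) ∉ X := by
    intro v g hg
    have hg' := Fintype.mem_piFinset.1 hg
    refine ⟨by simpa using hg' v.1, fun j hj => ?_⟩
    have := hg' j
    rw [if_neg hj] at this
    exact (Finset.mem_filter.1 this).2
  have hcard : ∀ v, (n - X.card) ^ (k - 1) ≤ (Q v).card := by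
    intro v
    rw [Fintype.card_piFinset, ← Finset.mul_prod_erase _ _ (Finset.mem_univ v.1), if_pos rfl,
      Finset.card_singleton, one_mul]
    have : (n - X.card) ^ (k - 1) = ∏ _j ∈ Finset.univ.erase v.1, (n - X.card) := by simp
    rw [this]
    refine Finset.prod_le_prod (fun _ _ => Nat.zero_le _) fun j hj => ?_
    rw [if_neg (Finset.ne_of_mem_erase hj)]
    have h1 := Finset.card_filter_add_card_filter_not (s := (Finset.univ : Finset (Fin n)))
      (fun y => (j, y) ∈ X)
    have h2 : (Finset.univ.filter (fun y => (j, y) ∈ X)).card ≤ X.card :=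
      Finset.card_le_card_of_injOn (fun y => (j, y)) (fun y hy => (Finset.mem_filter.1 hy).2)
        (fun _ _ _ _ h => (Prod.mk.inj h).2)
    rw [Finset.card_univ, Fintype.card_fin] at h1
    omega
  have hone : ∀ v ∈ X, ∀ g ∈ Q v, edgeOf g ∩ X = {v} := by
    rintro ⟨i, x⟩ hv g hg
    obtain ⟨h1, h2⟩ := hQ _ g hg
    ext ⟨j, y⟩
    simp only [Finset.mem_inter, mem_edgeOf, Finset.mem_singleton, Prod.mk.injEq]
    constructor
    · rintro ⟨rfl, h⟩
      by_cases hj : j = i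
      · subst hj; exact ⟨rfl, h1⟩
      · exact absurd h (h2 j hj)
    · rintro ⟨rfl, rfl⟩; exact ⟨h1, hv⟩
  calc X.card * (n - X.card) ^ (k - 1) = ∑ _v ∈ X, (n - X.card) ^ (k - 1) := by simp
    _ ≤ ∑ v ∈ X, (Q v).card := Finset.sum_le_sum fun v _ => hcard v
    _ = (X.biUnion Q).card := by
        rw [Finset.card_biUnion]
        intro u hu v hv huv
        rw [Function.onFun, Finset.disjoint_left]
        intro g hgu hgv
        have := (hone u hu g hgu).symm.trans (hone v hv g hgv)
        exact huv (Finset.singleton_injective this)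
    _ ≤ _ := by
        rw [card_filter_edges]
        refine Finset.card_le_card fun g hg => ?_
        obtain ⟨v, hv, hgv⟩ := Finset.mem_biUnion.1 hg
        exact Finset.mem_filter.2 ⟨Finset.mem_univ _, by
          rw [hone v hv g hgv, Finset.card_singleton]⟩

/-- A weighted count of the edges with at least two vertices in `X`. -/
lemma sum_pow_card_inter_le (hn : 0 < n) {X : Finset (Fin k × Fin n)} (hX : X.Nonempty) {t : ℝ}
    (ht : 0 ≤ t) (htX : t * X.card ≤ n) :
    ∑ e ∈ (completeBalanced k n).edges.filter (fun e => 2 ≤ (e ∩ X).card), t ^ (e ∩ X).card ≤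
      2 ^ k * n ^ k * (t * X.card / n) ^ 2 := by
  have hn' : (0 : ℝ) < n := by exact_mod_cast hn
  have hs : (0 : ℝ) < X.card := by exact_mod_cast hX.card_pos
  set u : ℝ := n / X.card with hu
  have hu0 : 0 < u := by positivity
  have hr1 : t * X.card / n ≤ 1 := by rw [div_le_one hn']; exact htX
  have hr0 : 0 ≤ t * X.card / n := by positivity
  -- The weight `t ^ b` with `b ≥ 2` is compared with `(t |X| / n) ^ 2` times `(n / |X|) ^ b`, whose
  -- sum over all edges factorizes over the classes.
  have h1 : ∀ b : ℕ, 2 ≤ b → t ^ b ≤ (t * X.card / n) ^ 2 * u ^ b := by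
    intro b hb
    have : t ^ b = (t * X.card / n) ^ b * u ^ b := by
      rw [← mul_pow]; congr 1; rw [hu]; field_simp
    rw [this]
    gcongr ?_ * _
    exact pow_le_pow_of_le_one hr0 hr1 hb
  calc _ ≤ ∑ e ∈ (completeBalanced k n).edges.filter (fun e => 2 ≤ (e ∩ X).card),
        (t * X.card / n) ^ 2 * u ^ (e ∩ X).card :=
        Finset.sum_le_sum fun e he => h1 _ (Finset.mem_filter.1 he).2
    _ ≤ ∑ e ∈ (completeBalanced k n).edges, (t * X.card / n) ^ 2 * u ^ (e ∩ X).card :=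
        Finset.sum_le_sum_of_subset_of_nonneg (Finset.filter_subset _ _)
          fun _ _ _ => by positivity
    _ = (t * X.card / n) ^ 2 * ∑ g : Fin k → Fin n, ∏ i, (if (i, g i) ∈ X then u else 1) := by
        rw [← Finset.mul_sum, sum_edges]
        congr 1
        refine Finset.sum_congr rfl fun g _ => ?_
        rw [card_edgeOf_inter, Finset.prod_ite]
        simp
    _ = (t * X.card / n) ^ 2 * ∏ i : Fin k, ∑ y : Fin n, (if (i, y) ∈ X then u else 1) := by
        rw [Finset.prod_univ_sum, Fintype.piFinset_univ]
    _ ≤ (t * X.card / n) ^ 2 * ∏ _i : Fin k, (2 * n : ℝ) := by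
        gcongr with i _
        rw [Finset.sum_ite]
        simp only [Finset.sum_const, nsmul_eq_mul, mul_one]
        have h2 : ((Finset.univ.filter (fun y => (i, y) ∈ X)).card : ℝ) ≤ X.card := by
          exact_mod_cast Finset.card_le_card_of_injOn (fun y => (i, y))
            (fun y hy => (Finset.mem_filter.1 hy).2) (fun _ _ _ _ h => (Prod.mk.inj h).2)
        have h3 : ((Finset.univ.filter (fun y => (i, y) ∉ X)).card : ℝ) ≤ n := by
          have := Finset.card_le_univ (Finset.univ.filter (fun y : Fin n => (i, y) ∉ X))
          rw [Fintype.card_fin] at this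
          exact_mod_cast this
        have h4 : ((Finset.univ.filter (fun y => (i, y) ∈ X)).card : ℝ) * u ≤ X.card * u := by
          gcongr
        have h5 : X.card * u = n := by rw [hu]; field_simp
        linarith
    _ = _ := by
        rw [Finset.prod_const, Finset.card_univ, Fintype.card_fin, mul_pow]; ring

end edgeOf

/-! ### Spanning trees in dense closed hypergraphs -/

section trees

variable {k : ℕ} {V : Type*} [DecidableEq V]

/-- A tree inside `H` that contains a given core extends to a spanning tree, provided that in every
nonempty set `X` outside the core some vertex `v` lies in `d` edges of `H` that meet `X` only
in `v`. -/
lemma exists_spanning_tree_of_core [Fintype V] {d : ℕ} {H : KGraph k V}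
    (hv : H.verts = Finset.univ) (hpart : H.IsPartite) (f : Fin k × Fin d ↪ V)
    (hf : ((completeBalanced k d).map f).edges ⊆ H.edges)
    (hX : ∀ X : Finset V, X.Nonempty → Disjoint X (Finset.univ.map f) →
      ∃ v ∈ X, d ≤ (H.edges.filter (fun e => e ∩ X = {v})).card) :
    ∃ T : KGraph k V, T.IsSpanningSubgraph H ∧ IsPartiteTree d T := by
  have key : ∀ (m : ℕ) (T : KGraph k V), T.vertsᶜ.card = m → IsBuiltByExtensions d T →
      T.edges ⊆ H.edges → Finset.univ.map f ⊆ T.verts →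
      ∃ T' : KGraph k V, T'.IsSpanningSubgraph H ∧ IsPartiteTree d T' := by
    intro m
    induction m with
    | zero =>
      intro T hT hb he _
      refine ⟨T, ⟨?_, he⟩, ?_, hb⟩
      · rw [hv]
        rw [Finset.card_eq_zero, Finset.compl_eq_empty_iff] at hT
        exact hT
      · obtain ⟨c, hc⟩ := hpart
        exact ⟨c, fun e h => hc e (he h)⟩
    | succ m ih =>
      intro T hT hb he hcore
      obtain ⟨v, hvX, hcard⟩ := hX T.vertsᶜ (Finset.card_pos.1 (by omega))
        (Finset.disjoint_left.2 fun u hu hu' => Finset.mem_compl.1 hu (hcore hu'))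
      obtain ⟨F, hF, hFd⟩ := Finset.exists_subset_card_eq hcard
      have hvT : v ∉ T.verts := Finset.mem_compl.1 hvX
      have hFH : ∀ e ∈ F, e ∈ H.edges ∧ v ∈ e ∧ e.erase v ⊆ T.verts := by
        intro e heF
        obtain ⟨h1, h2⟩ := Finset.mem_filter.1 (hF heF)
        refine ⟨h1, ?_, fun u hu => ?_⟩
        · exact (Finset.mem_inter.1 (h2 ▸ Finset.mem_singleton_self v : v ∈ e ∩ T.vertsᶜ)).1
        · by_contra hu'
          have : u ∈ e ∩ T.vertsᶜ :=
            Finset.mem_inter.2 ⟨Finset.mem_of_mem_erase hu, Finset.mem_compl.2 hu'⟩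
          rw [h2, Finset.mem_singleton] at this
          exact Finset.ne_of_mem_erase hu this
      let T' : KGraph k V :=
        { verts := insert v T.verts
          edges := T.edges ∪ F
          edge_subset := by
            intro e h
            rcases Finset.mem_union.1 h with h | h
            · exact (T.edge_subset e h).trans (Finset.subset_insert _ _)
            · rw [← Finset.insert_erase (hFH e h).2.1]
              exact Finset.insert_subset_insert _ (hFH e h).2.2
          edge_card := by
            intro e h
            rcases Finset.mem_union.1 h with h | h
            · exact T.edge_card e h
            · exact H.edge_card e (hFH e h).1 }
      refine ih T' ?_ (IsBuiltByExtensions.extend hb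
        ⟨v, hvT, rfl, F, hFd, fun e h => (hFH e h).2, rfl⟩) ?_ ?_
      · have h1 : T'.vertsᶜ = T.vertsᶜ.erase v := by
          ext u
          simp only [T', Finset.mem_compl, Finset.mem_insert, Finset.mem_erase, not_or]
        rw [h1, Finset.card_erase_of_mem hvX, hT, Nat.add_sub_cancel]
      · exact Finset.union_subset he fun e h => (hFH e h).1
      · exact hcore.trans (Finset.subset_insert _ _)
  refine key _ _ rfl (IsBuiltByExtensions.base f) hf ?_
  exact Finset.map_subset_map.2 subset_rfl

end trees

section core

variable {k n d : ℕ}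

lemma sum_sum_update (i : Fin k) (F : (Fin k → Fin n) → ℕ) :
    ∑ y : Fin k → Fin n, ∑ x : Fin n, F (Function.update y i x) = n * ∑ y, F y := by
  let Φ : ((Fin k → Fin n) × Fin n) ≃ ((Fin k → Fin n) × Fin n) :=
    { toFun := fun p => (Function.update p.1 i p.2, p.1 i)
      invFun := fun p => (Function.update p.1 i p.2, p.1 i)
      left_inv := fun p => by simp
      right_inv := fun p => by simp }
  rw [← Fintype.sum_prod_type' (fun y x => F (Function.update y i x))]
  have := Φ.sum_comp (fun p => F p.1)
  rw [Fintype.sum_prod_type] at this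
  rw [Fintype.sum_prod_type, show ∑ y : Fin k → Fin n, ∑ x : Fin n, F (Function.update y i x) =
    ∑ x : Fin k → Fin n, ∑ y : Fin n, F (Φ (x, y)).1 from rfl, ← Fintype.sum_prod_type
      (fun p : (Fin k → Fin n) × Fin n => F (Φ p).1), Φ.sum_comp (fun p => F p.1),
    Fintype.sum_prod_type]
  simp [Finset.mul_sum]

/-- The embedding of the vertices of `K_d^k` into those of `K_n^k` that shifts the `i`-th class by
`y i` modulo `n`. -/
def shiftEmbedding (hdn : d ≤ n) (y : Fin k → Fin n) : Fin k × Fin d ↪ Fin k × Fin n where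
  toFun v := (v.1, y v.1 + Fin.castLE hdn v.2)
  inj' := by
    rintro ⟨i, j⟩ ⟨i', j'⟩ h
    obtain ⟨rfl, h2⟩ := Prod.mk.inj h
    have := Fin.castLE_injective hdn (add_left_cancel h2)
    exact Prod.ext rfl this

/-- The vertices of the edge `h` of `K_d^k`, shifted by `y`. -/
def shiftEdge (hdn : d ≤ n) (y : Fin k → Fin n) (h : Fin k → Fin d) : Fin k → Fin n :=
  y + fun i => Fin.castLE hdn (h i)

lemma map_shiftEmbedding (hdn : d ≤ n) (y : Fin k → Fin n) (h : Fin k → Fin d) :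
    (edgeOf h).map (shiftEmbedding hdn y) = edgeOf (shiftEdge hdn y h) := by
  ext v
  simp only [edgeOf, shiftEmbedding, shiftEdge, Finset.mem_map, Finset.mem_image, Finset.mem_univ,
    true_and, exists_exists_eq_and, Pi.add_apply]
  rfl

/-- If few edges of `K_n^k` are missing from `H`, then an average shift of `K_d^k` lies in `H`, and
all but fewer than `D` vertices outside of it can be attached to it by `d` edges of `H`. -/
lemma exists_core [NeZero n] (hdn : d ≤ n) (hk : 2 ≤ k) {H : KGraph k (Fin k × Fin n)} {D : ℕ}
    (hmiss : d ^ k * (D + k * n) * ((completeBalanced k n).edges \ H.edges).card < D * n ^ k) :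
    ∃ (f : Fin k × Fin d ↪ Fin k × Fin n) (B : Finset (Fin k × Fin n)), B.card < D ∧
      ((completeBalanced k d).map f).edges ⊆ H.edges ∧
      ∀ v, v ∉ B →
        d ≤ (H.edges.filter (fun e => v ∈ e ∧ e.erase v ⊆ Finset.univ.map f)).card := by
  classical
  let F : (Fin k → Fin n) → ℕ := fun g => if edgeOf g ∈ H.edges then 0 else 1
  have hF : ∑ g, F g = ((completeBalanced k n).edges \ H.edges).card := by
    rw [Finset.sdiff_eq_filter, card_filter_edges, Finset.card_filter]
    exact Finset.sum_congr rfl fun g _ => by simp only [F]; split_ifs <;> simp_all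
  let T : (Fin k → Fin n) → ℕ := fun y => ∑ h : Fin k → Fin d,
    (D * F (shiftEdge hdn y h) + ∑ i : Fin k, ∑ x : Fin n,
      F (Function.update (shiftEdge hdn y h) i x))
  have hT : ∑ y, T y = d ^ k * (D + k * n) * ∑ g, F g := by
    have hshift : ∀ (h : Fin k → Fin d) (G : (Fin k → Fin n) → ℕ),
        ∑ y, G (shiftEdge hdn y h) = ∑ y, G y := fun h G =>
      Equiv.sum_comp (Equiv.addRight (fun i => Fin.castLE hdn (h i))) G
    simp only [T]
    rw [Finset.sum_comm]
    have : ∀ h : Fin k → Fin d, ∑ y : Fin k → Fin n, (D * F (shiftEdge hdn y h) +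
        ∑ i : Fin k, ∑ x : Fin n, F (Function.update (shiftEdge hdn y h) i x)) =
        (D + k * n) * ∑ g, F g := by
      intro h
      rw [hshift h (fun y => D * F y + ∑ i : Fin k, ∑ x : Fin n, F (Function.update y i x)),
        Finset.sum_add_distrib, ← Finset.mul_sum, Finset.sum_comm]
      simp_rw [sum_sum_update]
      simp
      ring
    rw [Finset.sum_congr rfl fun h _ => this h]
    simp
    ring
  obtain ⟨y, -, hy⟩ : ∃ y ∈ (Finset.univ : Finset (Fin k → Fin n)), T y < D := by
    apply Finset.exists_lt_of_sum_lt
    rw [hT, hF]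
    simpa [mul_comm] using hmiss
  have hcore : ∀ h, edgeOf (shiftEdge hdn y h) ∈ H.edges := by
    intro h
    by_contra hne
    have h1 : D * F (shiftEdge hdn y h) + ∑ i : Fin k, ∑ x : Fin n,
      F (Function.update (shiftEdge hdn y h) i x) ≤ T y :=
      Finset.single_le_sum (f := fun h => D * F (shiftEdge hdn y h) + ∑ i : Fin k, ∑ x : Fin n,
        F (Function.update (shiftEdge hdn y h) i x)) (fun _ _ => Nat.zero_le _)
        (Finset.mem_univ h)
    have h2 : F (shiftEdge hdn y h) = 1 := if_neg hne
    rw [h2] at h1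
    omega
  refine ⟨shiftEmbedding hdn y, Finset.univ.filter (fun v => ∃ h,
    edgeOf (Function.update (shiftEdge hdn y h) v.1 v.2) ∉ H.edges), ?_, ?_, ?_⟩
  · refine lt_of_le_of_lt ?_ hy
    rw [Finset.card_filter, Fintype.sum_prod_type]
    calc _ ≤ ∑ i : Fin k, ∑ x : Fin n, ∑ h : Fin k → Fin d,
          F (Function.update (shiftEdge hdn y h) i x) := by
          refine Finset.sum_le_sum fun i _ => Finset.sum_le_sum fun x _ => ?_
          split_ifs with hx
          · obtain ⟨h, hh⟩ := hx
            refine le_trans (le_of_eq ?_) (Finset.single_le_sum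
              (f := fun h => F (Function.update (shiftEdge hdn y h) i x))
              (fun _ _ => Nat.zero_le _) (Finset.mem_univ h))
            exact (if_neg hh).symm
          · exact Nat.zero_le _
      _ = ∑ h : Fin k → Fin d, ∑ i : Fin k, ∑ x : Fin n,
          F (Function.update (shiftEdge hdn y h) i x) := by
          symm
          rw [Finset.sum_comm]
          exact Finset.sum_congr rfl fun i _ => Finset.sum_comm
      _ ≤ T y := Finset.sum_le_sum fun h _ => Nat.le_add_left _ _
  · intro e he
    obtain ⟨e', he', rfl⟩ := Finset.mem_map.1 he
    obtain ⟨h, rfl⟩ := exists_edgeOf_eq he'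
    have := hcore h
    rw [← map_shiftEmbedding] at this
    exact this
  · intro v hv
    have hv' : ∀ h, edgeOf (Function.update (shiftEdge hdn y h) v.1 v.2) ∈ H.edges := by
      simpa using hv
    obtain ⟨j, hj⟩ : ∃ j : Fin k, j ≠ v.1 :=
      have : Nontrivial (Fin k) := Fin.nontrivial_iff_two_le.2 hk
      exists_ne v.1
    -- The constant edges `h = (t, …, t)` already give `d` distinct edges at `v`.
    let φ : Fin d → Finset (Fin k × Fin n) := fun t =>
      edgeOf (Function.update (shiftEdge hdn y (fun _ => t)) v.1 v.2)
    have hφ : Function.Injective φ := by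
      intro t t' h
      have h1 := congrFun (edgeOf_injective h) j
      rw [Function.update_of_ne hj, Function.update_of_ne hj] at h1
      exact Fin.castLE_injective hdn (add_left_cancel h1)
    have hcard : (Finset.univ.image φ).card = d := by
      rw [Finset.card_image_of_injective _ hφ, Finset.card_univ, Fintype.card_fin]
    refine hcard.ge.trans (Finset.card_le_card fun e he => ?_)
    obtain ⟨t, -, rfl⟩ := Finset.mem_image.1 he
    refine Finset.mem_filter.2 ⟨hv' _, ?_, ?_⟩
    · rw [mem_edgeOf, Function.update_self]
    · rintro ⟨l, z⟩ hu
      obtain ⟨hne, hu⟩ := Finset.mem_erase.1 hu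
      rw [mem_edgeOf] at hu
      by_cases hl : l = v.1
      · subst hl
        rw [Function.update_self] at hu
        exact absurd (show (v.1, z) = v from Prod.ext rfl hu.symm) hne
      · rw [Function.update_of_ne hl] at hu
        exact Finset.mem_map.2 ⟨(l, t), Finset.mem_univ _, Prod.ext rfl hu⟩

end core

/-! ### A deterministic criterion for a spanning tree at the hitting time -/

section criterion

/-- The elements of `E` whose label is at most `c`. -/
def labelSet {α : Type*} [DecidableEq α] {E : Finset α} {C : Type*} [LinearOrder C]
    (f : E → C) (c : C) : Finset α :=
  (Finset.univ.filter (fun e : E => f e ≤ c)).image (fun e : E => (e : α))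

section labelSet

variable {α : Type*} [DecidableEq α] {E : Finset α} {C : Type*} [LinearOrder C]

lemma mem_labelSet {f : E → C} {c : C} {e : α} :
    e ∈ labelSet f c ↔ ∃ h : e ∈ E, f ⟨e, h⟩ ≤ c := by
  simp [labelSet]

lemma labelSet_subset (f : E → C) (c : C) : labelSet f c ⊆ E := fun _ he =>
  (mem_labelSet.1 he).1

lemma labelSet_eq_initialSet {M : ℕ} {ω : Fin M ≃ E} {f : E → C} (hf : Monotone (f ∘ ω)) (c : C) :
    ∃ m, labelSet f c = initialSet ω m := by
  by_cases hex : ∃ m, ∃ h : m < M, c < f (ω ⟨m, h⟩)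
  · classical
    refine ⟨Nat.find hex, ?_⟩
    obtain ⟨hM, hlt⟩ := Nat.find_spec hex
    ext e
    rw [mem_labelSet, mem_initialSet]
    constructor
    · rintro ⟨he, hle⟩
      refine ⟨ω.symm ⟨e, he⟩, ?_, by simp⟩
      by_contra hge
      have h1 : (⟨Nat.find hex, hM⟩ : Fin M) ≤ ω.symm ⟨e, he⟩ := not_lt.1 hge
      have h2 := hf h1
      simp only [Function.comp_apply, Equiv.apply_symm_apply] at h2
      exact absurd (hlt.trans_le h2) (not_lt.2 hle)
    · rintro ⟨i, hi, rfl⟩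
      refine ⟨(ω i).2, ?_⟩
      by_contra hgt
      exact Nat.find_min hex hi ⟨i.2, not_le.1 hgt⟩
  · refine ⟨M, ?_⟩
    push Not at hex
    ext e
    rw [mem_labelSet, mem_initialSet]
    constructor
    · rintro ⟨he, -⟩
      exact ⟨ω.symm ⟨e, he⟩, Fin.is_lt _, by simp⟩
    · rintro ⟨i, -, rfl⟩
      exact ⟨(ω i).2, hex i i.2⟩

end labelSet

variable {k n d : ℕ}

lemma KGraph.minDegreeAtLeast_mono {G : KGraph k (Fin k × Fin n)}
    {A B : Finset (Finset (Fin k × Fin n))} (hAB : A ⊆ B)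
    (h : (G.restrictEdges A).MinDegreeAtLeast d) : (G.restrictEdges B).MinDegreeAtLeast d :=
  fun v hv => (h v hv).trans (Finset.card_le_card
    (Finset.filter_subset_filter _ (Finset.inter_subset_inter_left hAB)))

lemma randomGraph_edges (ω : EdgeOrdering k n) (m : ℕ) :
    (randomGraph ω m).edges = initialSet ω m :=
  Finset.inter_eq_right.2 (initialSet_subset ω m)

lemma completeBalanced_isPartite : (completeBalanced k n).IsPartite :=
  ⟨Prod.fst, fun _ he => (Finset.mem_filter.1 he).2⟩

/-- The vertex set `X` could obstruct the growth of a tree: every vertex of `X` lies in an edge with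
label at most `1` that meets `X` in a second vertex, and at most `d |X|` edges with label `0` meet
`X` in exactly one vertex. -/
def IsStuck (d : ℕ) (X : Finset (Fin k × Fin n)) (f : (completeBalanced k n).edges → Fin 3) :
    Prop :=
  (∀ v ∈ X, ∃ e ∈ labelSet f 1, v ∈ e ∧ 2 ≤ (e ∩ X).card) ∧
    ((labelSet f 0).filter (fun e => (e ∩ X).card = 1)).card ≤ X.card * d

/-- If no vertex of `X` has `d` edges of `A` that meet `X` only in it, although all degrees in `A`
are at least `d`, then `X` is stuck for every labelling that is compatible with `A`. -/
lemma isStuck_of_forall_lt {f : (completeBalanced k n).edges → Fin 3}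
    {A : Finset (Finset (Fin k × Fin n))} (h0 : labelSet f 0 ⊆ A) (h1 : A ⊆ labelSet f 1)
    (hA : ∀ v, d ≤ (A.filter (fun e => v ∈ e)).card) {X : Finset (Fin k × Fin n)}
    (hX : ∀ v ∈ X, (A.filter (fun e => e ∩ X = {v})).card < d) : IsStuck d X f := by
  constructor
  · intro v hv
    obtain ⟨e, he, hne⟩ : ∃ e ∈ A.filter (fun e => v ∈ e), e ∉ A.filter (fun e => e ∩ X = {v}) := by
      by_contra hcon
      push Not at hcon
      exact absurd (Finset.card_le_card hcon) (not_le.2 ((hX v hv).trans_le (hA v)))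
    obtain ⟨heA, hve⟩ := Finset.mem_filter.1 he
    refine ⟨e, h1 heA, hve, ?_⟩
    have hvm : v ∈ e ∩ X := Finset.mem_inter.2 ⟨hve, hv⟩
    by_contra hlt
    have hc : (e ∩ X).card = 1 := by
      have := Finset.card_pos.2 ⟨v, hvm⟩
      omega
    obtain ⟨u, hu⟩ := Finset.card_eq_one.1 hc
    rw [hu, Finset.mem_singleton] at hvm
    exact hne (Finset.mem_filter.2 ⟨heA, hvm ▸ hu⟩)
  · have hsub : (labelSet f 0).filter (fun e => (e ∩ X).card = 1) ⊆
        X.biUnion (fun v => A.filter (fun e => e ∩ X = {v})) := by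
      intro e he
      obtain ⟨he0, he1⟩ := Finset.mem_filter.1 he
      obtain ⟨v, hv⟩ := Finset.card_eq_one.1 he1
      have hvX : v ∈ e ∩ X := hv ▸ Finset.mem_singleton_self v
      exact Finset.mem_biUnion.2 ⟨v, (Finset.mem_inter.1 hvX).2,
        Finset.mem_filter.2 ⟨h0 he0, hv⟩⟩
    exact (Finset.card_le_card hsub).trans
      (Finset.card_biUnion_le_card_mul _ _ _ fun v hv => (hX v hv).le)

lemma minDegreeAtLeast_hittingTime {ω : EdgeOrdering k n} {m : ℕ}
    (h : (randomGraph ω m).MinDegreeAtLeast d) :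
    (randomGraph ω (hittingTime d ω)).MinDegreeAtLeast d :=
  Nat.sInf_mem (s := {m : ℕ | (randomGraph ω m).MinDegreeAtLeast d}) ⟨m, h⟩

/-- Suppose that the labels increase along the ordering `ω`, that there are more than `m` labels `0`
and the closure of the first `m` edges is almost everything, that the edges with label at most `1`
have minimum degree `d` but those with label `0` do not, and that no small set is stuck. Then the
closure at the hitting time has a spanning tree. -/
lemma exists_spanning_tree_of_labels (hk : 2 ≤ k) (hn : 0 < n) (hdn : d ≤ n)
    (P : Polymatroid (completeBalanced k n).edges) (ω : EdgeOrdering k n)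
    (f : (completeBalanced k n).edges → Fin 3) (hf : Monotone (f ∘ ω)) (D m : ℕ)
    (hcl : d ^ k * (D + k * n) *
      ((completeBalanced k n).edges \ P.closure (initialSet ω m)).card < D * n ^ k)
    (hm : m < (labelSet f 0).card)
    (h0 : ¬ ((completeBalanced k n).restrictEdges (labelSet f 0)).MinDegreeAtLeast d)
    (h1 : ((completeBalanced k n).restrictEdges (labelSet f 1)).MinDegreeAtLeast d)
    (hX : ∀ X : Finset (Fin k × Fin n), X.Nonempty → X.card < D → ¬ IsStuck d X f) :
    ∃ T : KGraph k (Fin k × Fin n),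
      T.IsSpanningSubgraph (closureGraph P (randomGraph ω (hittingTime d ω))) ∧
        IsPartiteTree d T := by
  have : NeZero n := ⟨hn.ne'⟩
  obtain ⟨m0, hm0⟩ := labelSet_eq_initialSet hf 0
  obtain ⟨m1, hm1⟩ := labelSet_eq_initialSet hf 1
  set h := hittingTime d ω with hh
  have hdeg1 : (randomGraph ω m1).MinDegreeAtLeast d := by rw [hm1] at h1; exact h1
  have hdeg : (randomGraph ω h).MinDegreeAtLeast d := minDegreeAtLeast_hittingTime hdeg1
  have hle1 : h ≤ m1 := Nat.sInf_le hdeg1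
  have hm0h : m0 ≤ h := by
    by_contra hlt
    refine h0 ?_
    rw [hm0]
    exact KGraph.minDegreeAtLeast_mono (initialSet_mono ω (not_le.1 hlt).le) hdeg
  have hmm0 : m ≤ m0 := by
    rw [hm0] at hm
    exact (hm.trans_le (card_initialSet_le ω m0)).le
  set A := initialSet ω h with hA
  have hedges : (closureGraph P (randomGraph ω h)).edges = P.closure A := by
    change (completeBalanced k n).edges ∩ P.closure (randomGraph ω h).edges = _
    rw [randomGraph_edges]
    exact Finset.inter_eq_right.2 (Finset.filter_subset _ _)
  have hAcl : A ⊆ P.closure A := P.subset_closure (initialSet_subset ω h)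
  have hAdeg : ∀ v, d ≤ (A.filter (fun e => v ∈ e)).card := by
    intro v
    have := hdeg v (Finset.mem_univ v)
    rwa [KGraph.degree, randomGraph_edges] at this
  obtain ⟨φ, B, hB, hcore, hatt⟩ := exists_core hdn hk (H := closureGraph P (randomGraph ω h))
    (D := D) (by
      rw [hedges]
      refine lt_of_le_of_lt (Nat.mul_le_mul_left _ (Finset.card_le_card ?_)) hcl
      exact Finset.sdiff_subset_sdiff subset_rfl
        (P.closure_mono (initialSet_mono ω (hmm0.trans hm0h)) (initialSet_subset ω h)))
  refine exists_spanning_tree_of_core rfl ?_ φ hcore fun X hXne hXcore => ?_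
  · obtain ⟨c, hc⟩ := completeBalanced_isPartite (k := k) (n := n)
    exact ⟨c, fun e he => hc e (Finset.mem_inter.1 he).1⟩
  · by_cases hXB : X ⊆ B
    · by_contra hcon
      push Not at hcon
      refine hX X hXne ((Finset.card_le_card hXB).trans_lt hB) (isStuck_of_forall_lt (A := A)
        (hm0 ▸ initialSet_mono ω hm0h) (hm1 ▸ initialSet_mono ω hle1) hAdeg fun v hv => ?_)
      refine lt_of_le_of_lt (Finset.card_le_card ?_) (hcon v hv)
      rw [hedges]
      exact Finset.filter_subset_filter _ hAcl
    · obtain ⟨v, hvX, hvB⟩ := Finset.not_subset.1 hXB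
      refine ⟨v, hvX, (hatt v hvB).trans (Finset.card_le_card fun e he => ?_)⟩
      obtain ⟨he1, hve, he2⟩ := Finset.mem_filter.1 he
      refine Finset.mem_filter.2 ⟨he1, ?_⟩
      ext u
      rw [Finset.mem_inter, Finset.mem_singleton]
      constructor
      · rintro ⟨hue, huX⟩
        by_contra huv
        exact Finset.disjoint_left.1 hXcore huX (he2 (Finset.mem_erase.2 ⟨huv, hue⟩))
      · rintro rfl
        exact ⟨hve, hvX⟩

/-- The case `k = d = 1`: all vertices are covered only when all edges are present. -/
lemma exists_spanning_tree_of_uniformity_one (hn : 0 < n)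
    (P : Polymatroid (completeBalanced 1 n).edges) (ω : EdgeOrdering 1 n) :
    ∃ T : KGraph 1 (Fin 1 × Fin n),
      T.IsSpanningSubgraph (closureGraph P (randomGraph ω (hittingTime 1 ω))) ∧
        IsPartiteTree 1 T := by
  have : NeZero n := ⟨hn.ne'⟩
  have hone : ∀ e ∈ (completeBalanced 1 n).edges, ∀ v ∈ e, e = {v} := by
    intro e he v hv
    obtain ⟨u, hu⟩ := Finset.card_eq_one.1 ((completeBalanced 1 n).edge_card e he)
    rw [hu, Finset.mem_singleton] at hv
    rw [hu, hv]
  have hall : (randomGraph ω (completeBalanced 1 n).edges.card).MinDegreeAtLeast 1 := by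
    intro v _
    rw [KGraph.degree, randomGraph_edges, Nat.one_le_iff_ne_zero, Finset.card_ne_zero]
    have he := edgeOf_mem (k := 1) (fun _ => v.2)
    refine ⟨edgeOf (fun _ => v.2), Finset.mem_filter.2 ⟨?_, mem_edgeOf.2 rfl⟩⟩
    exact mem_initialSet.2 ⟨ω.symm ⟨_, he⟩, Fin.is_lt _, by simp⟩
  have hdeg := minDegreeAtLeast_hittingTime hall
  set H := closureGraph P (randomGraph ω (hittingTime 1 ω)) with hH
  have hsing : ∀ v, {v} ∈ H.edges := by
    intro v
    have h1 := hdeg v (Finset.mem_univ v)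
    rw [KGraph.degree, randomGraph_edges, Nat.one_le_iff_ne_zero, Finset.card_ne_zero] at h1
    obtain ⟨e, he⟩ := h1
    obtain ⟨he, hve⟩ := Finset.mem_filter.1 he
    have heE := initialSet_subset _ _ he
    rw [← hone e heE v hve]
    refine Finset.mem_inter.2 ⟨heE, ?_⟩
    rw [randomGraph_edges]
    exact P.subset_closure (initialSet_subset _ _) he
  refine exists_spanning_tree_of_core rfl ?_
    ⟨fun v => (v.1, 0), fun u v h => Prod.ext (Prod.mk.inj h).1 (Subsingleton.elim _ _)⟩ ?_ ?_
  · obtain ⟨c, hc⟩ := completeBalanced_isPartite (k := 1) (n := n)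
    exact ⟨c, fun e he => hc e (Finset.mem_inter.1 he).1⟩
  · intro e he
    obtain ⟨e', he', rfl⟩ := Finset.mem_map.1 he
    obtain ⟨u, hu⟩ := Finset.card_eq_one.1 ((completeBalanced 1 1).edge_card e' he')
    rw [hu]
    exact hsing _
  · rintro X ⟨v, hv⟩ -
    refine ⟨v, hv, ?_⟩
    rw [Nat.one_le_iff_ne_zero, Finset.card_ne_zero]
    exact ⟨{v}, Finset.mem_filter.2 ⟨hsing v, Finset.singleton_inter_of_mem hv⟩⟩

end criterion

/-! ### Tail bounds for random labels -/

section tails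

variable {α : Type*} [DecidableEq α] {E : Finset α} {C : Type*} [Fintype C] [LinearOrder C]
  {w : C → ℝ}

lemma sum_label_ite (hw1 : ∑ c, w c = 1) (a : C) (x : ℝ) :
    ∑ c, w c * (if c ≤ a then x else 1) =
      1 + (∑ c ∈ Finset.univ.filter (· ≤ a), w c) * (x - 1) := by
  trans ∑ c, w c + (∑ c ∈ Finset.univ.filter (· ≤ a), w c) * (x - 1)
  · rw [Finset.sum_mul, Finset.sum_filter, ← Finset.sum_add_distrib]
    refine Finset.sum_congr rfl fun c _ => ?_
    split_ifs <;> ring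
  · rw [hw1]

/-- An exponential moment bound. The event says that the elements of `F` with label at most `b`
have total weight at least `s`, while at most `t` elements of a set `A` disjoint from `F` have label
at most `a`. -/
lemma labelProb_weight_ge_card_le (hw : ∀ c, 0 ≤ w c) (hw1 : ∑ c, w c = 1)
    {A F : Finset α} (hA : A ⊆ E) (hF : F ⊆ E) (hAF : Disjoint A F) (a b : C) (β : α → ℕ)
    {s t : ℕ} {l θ : ℝ} (hl : 1 ≤ l) (hθ : 0 < θ) (hθ1 : θ ≤ 1) :
    labelProb w {f : E → C | s ≤ ∑ e ∈ F.filter (· ∈ labelSet f b), β e ∧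
        (A.filter (· ∈ labelSet f a)).card ≤ t} ≤
      (l ^ s)⁻¹ * (θ ^ t)⁻¹ *
        (Real.exp ((∑ c ∈ Finset.univ.filter (· ≤ b), w c) * ∑ e ∈ F, l ^ β e) *
          Real.exp (-((1 - θ) * (∑ c ∈ Finset.univ.filter (· ≤ a), w c) * A.card))) := by
  set pb := ∑ c ∈ Finset.univ.filter (· ≤ b), w c with hpb
  set pa := ∑ c ∈ Finset.univ.filter (· ≤ a), w c with hpa
  have hpb0 : 0 ≤ pb := Finset.sum_nonneg fun _ _ => hw _
  have hl0 : 0 < l := by linarith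
  let g : E → C → ℝ := fun e c =>
    (if (e : α) ∈ F then (if c ≤ b then l ^ β e else 1) else 1) *
      (if (e : α) ∈ A then (if c ≤ a then θ else 1) else 1)
  have hg0 : ∀ e c, 0 ≤ g e c := by
    intro e c
    simp only [g]
    split_ifs <;> positivity
  refine (labelProb_le_prod hw _ g ((l ^ s)⁻¹ * (θ ^ t)⁻¹) hg0 (by positivity) ?_).trans ?_
  · rintro f ⟨hs, ht⟩
    have h1 : ∏ e : E, g e (f e) = l ^ (∑ e ∈ F.filter (· ∈ labelSet f b), β e) *
        θ ^ (A.filter (· ∈ labelSet f a)).card := by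
      have hmem : ∀ (e : E) (c : C), (e : α) ∈ labelSet f c ↔ f e ≤ c := fun e c => by
        rw [mem_labelSet]; simp
      have h2 : ∀ e : E, g e (f e) =
          (if (e : α) ∈ F.filter (· ∈ labelSet f b) then l ^ β e else 1) *
            (if (e : α) ∈ A.filter (· ∈ labelSet f a) then θ else 1) := by
        intro e
        simp only [g, Finset.mem_filter, hmem, ite_and]
      rw [Finset.prod_congr rfl fun e _ => h2 e, Finset.prod_coe_sort E (fun e =>
        (if e ∈ F.filter (· ∈ labelSet f b) then l ^ β e else 1) *
            (if e ∈ A.filter (· ∈ labelSet f a) then θ else 1)), Finset.prod_mul_distrib,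
        Finset.prod_ite_mem, Finset.prod_ite_mem, Finset.prod_const,
        Finset.inter_eq_right.2 ((Finset.filter_subset _ _).trans hF),
        Finset.inter_eq_right.2 ((Finset.filter_subset _ _).trans hA), Finset.prod_pow_eq_pow_sum]
    rw [h1, show (l ^ s)⁻¹ * (θ ^ t)⁻¹ * (l ^ (∑ e ∈ F.filter (· ∈ labelSet f b), β e) *
        θ ^ (A.filter (· ∈ labelSet f a)).card) =
        ((l ^ s)⁻¹ * l ^ (∑ e ∈ F.filter (· ∈ labelSet f b), β e)) *
        ((θ ^ t)⁻¹ * θ ^ (A.filter (· ∈ labelSet f a)).card) by ring]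
    refine one_le_mul_of_one_le_of_one_le ?_ ?_
    · rw [inv_mul_eq_div, one_le_div (by positivity)]
      exact pow_le_pow_right₀ hl hs
    · -- The factor is at least one since `θ ≤ 1` and the exponent of `θ` is at most `t`.
      have h3 : θ ^ t ≤ θ ^ (A.filter (· ∈ labelSet f a)).card :=
        pow_le_pow_of_le_one hθ.le hθ1 ht
      rw [inv_mul_eq_div, one_le_div (by positivity)]
      exact h3
  · gcongr ?_ * ?_
    have h2 : ∀ e : E, ∑ c, w c * g e c ≤
        (if (e : α) ∈ F then Real.exp (pb * l ^ β e) else 1) *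
          (if (e : α) ∈ A then Real.exp (-((1 - θ) * pa)) else 1) := by
      intro e
      by_cases heF : (e : α) ∈ F
      · have heA : (e : α) ∉ A := fun h => Finset.disjoint_left.1 hAF h heF
        simp only [g, heF, heA, if_true, if_false, mul_one]
        rw [sum_label_ite hw1]
        have := Real.add_one_le_exp (pb * l ^ β (e : α))
        rw [← hpb]
        nlinarith
      · by_cases heA : (e : α) ∈ A
        · simp only [g, heF, heA, if_true, if_false, one_mul]
          rw [sum_label_ite hw1]
          have := Real.add_one_le_exp (-((1 - θ) * pa))
          rw [← hpa]
          nlinarith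
        · simp [g, heF, heA, hw1]
    refine (Finset.prod_le_prod (fun e _ => Finset.sum_nonneg fun c _ =>
      mul_nonneg (hw c) (hg0 e c)) fun e _ => h2 e).trans (le_of_eq ?_)
    rw [Finset.prod_coe_sort E (fun e => (if e ∈ F then Real.exp (pb * l ^ β e) else 1) *
          (if e ∈ A then Real.exp (-((1 - θ) * pa)) else 1)), Finset.prod_mul_distrib,
        Finset.prod_ite_mem, Finset.prod_ite_mem, Finset.inter_eq_right.2 hF,
        Finset.inter_eq_right.2 hA, Finset.prod_const, ← Real.exp_sum, ← Finset.mul_sum,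
        ← Real.exp_nat_mul]
    congr 2
    ring

lemma labelProb_card_le (hw : ∀ c, 0 ≤ w c) (hw1 : ∑ c, w c = 1)
    {A : Finset α} (hA : A ⊆ E) (a : C) (t : ℕ) :
    labelProb w {f : E → C | (A.filter (· ∈ labelSet f a)).card ≤ t} ≤
      2 ^ t * Real.exp (-((∑ c ∈ Finset.univ.filter (· ≤ a), w c) * A.card / 2)) := by
  have h := labelProb_weight_ge_card_le (E := E) hw hw1 hA (Finset.empty_subset _)
    (Finset.disjoint_empty_right _) a a (fun _ => 0) (s := 0) (t := t) (l := 1) (θ := 1 / 2) le_rfl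
    (by norm_num) (by norm_num)
  simp only [Nat.zero_le, true_and, pow_zero, inv_one, one_mul, Finset.sum_empty, mul_zero,
    Real.exp_zero] at h
  refine h.trans (le_of_eq ?_)
  rw [one_div, inv_pow, inv_inv]
  congr 2
  ring

end tails

section coverage

variable {α : Type*} [DecidableEq α] {E : Finset α} {C : Type*} [Fintype C] [LinearOrder C]
  {w : C → ℝ} {ι : Type*} [Fintype ι]

/-- If every element of `ι` is covered by `N` elements of `E`, and these are disjoint for distinct
elements of `ι`, then the elements with labels at most `a` cover all of `ι` with the stated
probability, by inclusion and exclusion over the set of uncovered elements. -/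
lemma labelProb_cover (hw1 : ∑ c, w c = 1) (a : C) (r : ι → α → Prop) (N : ℕ)
    [∀ S : Finset ι, DecidablePred fun e => ∃ x ∈ S, r x e]
    (hr : ∀ S : Finset ι, (E.filter (fun e => ∃ x ∈ S, r x e)).card = S.card * N) :
    labelProb w {f : E → C | ∀ x : ι, ∃ e ∈ labelSet f a, r x e} =
      (1 - (1 - ∑ c ∈ Finset.univ.filter (· ≤ a), w c) ^ N) ^ Fintype.card ι := by
  classical
  set pa := ∑ c ∈ Finset.univ.filter (· ≤ a), w c with hpa
  let g : Finset (ι) → E → C → ℝ := fun S e c =>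
    if ∃ x ∈ S, r x e then (if c ≤ a then 0 else 1) else 1
  have hI : ∀ (f : E → C) (S : Finset (ι)),
      (∏ e, g S e (f e)) = ∏ x ∈ S, if ∃ e ∈ labelSet f a, r x e then (0 : ℝ) else 1 := by
    intro f S
    by_cases h : ∃ x ∈ S, ∃ e ∈ labelSet f a, r x e
    · obtain ⟨x, hx, e, he, hxe⟩ := h
      obtain ⟨heE, hle⟩ := mem_labelSet.1 he
      have hz : (if ∃ e ∈ labelSet f a, r x e then (0 : ℝ) else 1) = 0 :=
        if_pos ⟨e, he, hxe⟩
      rw [Finset.prod_eq_zero hx hz]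
      refine Finset.prod_eq_zero (Finset.mem_univ ⟨e, heE⟩) ?_
      simp only [g]
      rw [if_pos ⟨x, hx, hxe⟩, if_pos hle]
    · push Not at h
      rw [Finset.prod_eq_one, Finset.prod_eq_one]
      · intro x hx
        rw [if_neg]
        rintro ⟨e, he, hxe⟩
        exact h x hx e he hxe
      · intro e _
        simp only [g]
        split_ifs with h1 h2
        · obtain ⟨x, hx, hxe⟩ := h1
          exact absurd hxe (h x hx e (mem_labelSet.2 ⟨e.2, h2⟩))
        · rfl
        · rfl
  have hE : ∀ S : Finset (ι), ∏ e, ∑ c, w c * g S e c = ((1 - pa) ^ N) ^ S.card := by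
    intro S
    have h1 : ∀ e : E, ∑ c, w c * g S e c =
        if ∃ x ∈ S, r x e then 1 - pa else 1 := by
      intro e
      simp only [g]
      split_ifs with h
      · rw [sum_label_ite hw1]; ring
      · simpa using hw1
    rw [Finset.prod_congr rfl fun e _ => h1 e, Finset.prod_coe_sort E
      (fun e => if ∃ x ∈ S, r x e then 1 - pa else 1), ← Finset.prod_filter,
      Finset.prod_const, hr, ← pow_mul, mul_comm]
  have hind : ∀ f : E → C,
      Set.indicator {f : E → C |
        ∀ x : ι, ∃ e ∈ labelSet f a, r x e} (fun f => ∏ e, w (f e)) f =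
      ∑ S : Finset (ι), (-1) ^ S.card * ((∏ e, w (f e)) * ∏ e, g S e (f e)) := by
    intro f
    have h1 : ∏ x : ι, (1 + -(if ∃ e ∈ labelSet f a, r x e then (0 : ℝ) else 1)) =
        ∑ S : Finset (ι), (-1) ^ S.card * ∏ e, g S e (f e) := by
      rw [Finset.prod_one_add, Finset.powerset_univ]
      refine Finset.sum_congr rfl fun S _ => ?_
      rw [hI, Finset.prod_neg]
    have h2 : ∑ S : Finset (ι), (-1) ^ S.card * ((∏ e, w (f e)) * ∏ e, g S e (f e)) =
        (∏ e, w (f e)) * ∑ S : Finset (ι), (-1) ^ S.card * ∏ e, g S e (f e) := by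
      rw [Finset.mul_sum]
      exact Finset.sum_congr rfl fun S _ => by ring
    rw [h2, ← h1]
    by_cases h : ∀ x : ι, ∃ e ∈ labelSet f a, r x e
    · have h4 : ∏ x : ι, (1 + -(if ∃ e ∈ labelSet f a, r x e then (0 : ℝ) else 1)) = 1 :=
        Finset.prod_eq_one fun x _ => by rw [if_pos (h x)]; simp
      rw [Set.indicator_of_mem (by exact h), h4, mul_one]
    · rw [Set.indicator_of_notMem (by exact h)]
      push Not at h
      obtain ⟨x, hx⟩ := h
      rw [Finset.prod_eq_zero (Finset.mem_univ x), mul_zero]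
      rw [if_neg (by push Not; exact hx)]; simp
  unfold labelProb
  rw [Finset.sum_congr rfl fun f _ => hind f, Finset.sum_comm]
  simp_rw [← Finset.mul_sum, sum_prod_label, hE]
  have h3 := Finset.prod_one_add (s := (Finset.univ : Finset (ι)))
    (f := fun _ => -((1 - pa) ^ N))
  rw [Finset.prod_const, Finset.card_univ, Finset.powerset_univ] at h3
  rw [sub_eq_add_neg 1 ((1 - pa) ^ N), h3]
  refine Finset.sum_congr rfl fun S _ => ?_
  rw [Finset.prod_const, neg_pow ((1 - pa) ^ N)]

end coverage

/-! ### The failure probability for fixed `n` -/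

section failure

variable {k n d : ℕ}

/-- The distribution of the label of an edge: the label is `0` with probability `p` and at most `1`
with probability `q`. -/
def labelWeight (p q : ℝ) : Fin 3 → ℝ := ![p, q - p, 1 - q]

lemma labelWeight_nonneg {p q : ℝ} (hp : 0 ≤ p) (hpq : p ≤ q) (hq : q ≤ 1) (c : Fin 3) :
    0 ≤ labelWeight p q c := by
  fin_cases c <;> simp [labelWeight] <;> linarith

lemma sum_labelWeight (p q : ℝ) : ∑ c, labelWeight p q c = 1 := by
  simp [labelWeight, Fin.sum_univ_three]

lemma sum_labelWeight_le_zero (p q : ℝ) :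
    ∑ c ∈ Finset.univ.filter (· ≤ (0 : Fin 3)), labelWeight p q c = p := by
  rw [Finset.sum_filter]
  simp [labelWeight]

lemma sum_labelWeight_le_one (p q : ℝ) :
    ∑ c ∈ Finset.univ.filter (· ≤ (1 : Fin 3)), labelWeight p q c = q := by
  rw [Finset.sum_filter]
  have : ¬ ((2 : Fin 3) ≤ 1) := by decide
  simp [labelWeight, Fin.sum_univ_three, this]

lemma labelProb_isStuck_le (hn : 0 < n) {p q : ℝ} (hp : 0 ≤ p) (hpq : p ≤ q) (hq : q ≤ 1)
    {X : Finset (Fin k × Fin n)} (hX : X.Nonempty) {l θ : ℝ} (hl : 1 ≤ l) (hlX : l * X.card ≤ n)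
    (hθ : 0 < θ) (hθ1 : θ ≤ 1) :
    labelProb (labelWeight p q) {f | IsStuck d X f} ≤
      (l ^ X.card)⁻¹ * (θ ^ (X.card * d))⁻¹ *
        (Real.exp (q * (2 ^ k * n ^ k * (l * X.card / n) ^ 2)) *
          Real.exp (-((1 - θ) * p * (X.card * (n - X.card : ℝ) ^ (k - 1))))) := by
  have hw := labelWeight_nonneg hp hpq hq
  set A := (completeBalanced k n).edges.filter (fun e => (e ∩ X).card = 1) with hA
  set F := (completeBalanced k n).edges.filter (fun e => 2 ≤ (e ∩ X).card) with hF
  have hAF : Disjoint A F := by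
    rw [Finset.disjoint_left]
    intro e h1 h2
    have h1 := (Finset.mem_filter.1 h1).2
    have h2 := (Finset.mem_filter.1 h2).2
    omega
  have hsub : {f : (completeBalanced k n).edges → Fin 3 | IsStuck d X f} ⊆
      {f | X.card ≤ ∑ e ∈ F.filter (· ∈ labelSet f 1), (e ∩ X).card ∧
        (A.filter (· ∈ labelSet f 0)).card ≤ X.card * d} := by
    rintro f ⟨h1, h2⟩
    constructor
    · refine (Finset.card_le_card (t := (F.filter (· ∈ labelSet f 1)).biUnion (fun e => e ∩ X))
        fun v hv => ?_).trans Finset.card_biUnion_le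
      obtain ⟨e, he, hve, hcard⟩ := h1 v hv
      exact Finset.mem_biUnion.2 ⟨e, Finset.mem_filter.2 ⟨Finset.mem_filter.2
        ⟨labelSet_subset _ _ he, hcard⟩, he⟩, Finset.mem_inter.2 ⟨hve, hv⟩⟩
    · refine (Finset.card_le_card fun e he => ?_).trans h2
      obtain ⟨heA, he0⟩ := Finset.mem_filter.1 he
      exact Finset.mem_filter.2 ⟨he0, (Finset.mem_filter.1 heA).2⟩
  refine (labelProb_mono hw hsub).trans
    ((labelProb_weight_ge_card_le hw (sum_labelWeight p q) (Finset.filter_subset _ _)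
      (Finset.filter_subset _ _) hAF 0 1 _ hl hθ hθ1).trans ?_)
  rw [sum_labelWeight_le_zero, sum_labelWeight_le_one]
  have hs : X.card ≤ n := by
    have h1 : (1 : ℝ) * X.card ≤ l * X.card := by gcongr
    have h2 : (X.card : ℝ) ≤ n := by linarith
    exact_mod_cast h2
  have hAcard : (X.card * (n - X.card : ℝ) ^ (k - 1)) ≤ A.card := by
    have := card_inter_eq_one_ge X
    rw [← Nat.cast_sub hs]
    exact_mod_cast this
  have hFsum := sum_pow_card_inter_le hn hX (by linarith : 0 ≤ l) hlX
  have h1θ : 0 ≤ (1 - θ) * p := mul_nonneg (by linarith) hp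
  have hq0 : 0 ≤ q := hp.trans hpq
  have hl0 : 0 < l := by linarith
  gcongr

/-- The failure probability is at most the sum of the probabilities of five events: the closure of
the first `m` edges is too small; at most `m` edges have label `0`; these edges cover a whole class;
the edges with label at most `1` do not have minimum degree `d`; some small set is stuck. -/
lemma uniformProb_no_spanning_tree_le (hk : 2 ≤ k) (hn : 0 < n) (hd : 0 < d) (hdn : d ≤ n) {a : ℕ}
    (P : Polymatroid (completeBalanced k n).edges) (hP : P.rank ≤ (a : ℤ) * n)
    {p q η : ℝ} (hp : 0 ≤ p) (hpq : p ≤ q) (hq : q ≤ 1) (hη : 0 < η) {D m : ℕ} (hD : 0 < D)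
    (hηD : (d : ℝ) ^ k * (D + k * n) * η ≤ D) (hm0 : 0 < m) (hm : m ≤ n ^ k) :
    uniformProb {ω : EdgeOrdering k n | ¬ ∃ T : KGraph k (Fin k × Fin n),
      T.IsSpanningSubgraph (closureGraph P (randomGraph ω (hittingTime d ω))) ∧
        IsPartiteTree d T} ≤
      a * n / (m * η) + (2 ^ m * Real.exp (-(p * n ^ k / 2)) + ((1 - (1 - p) ^ n ^ (k - 1)) ^ n +
        (k * n * (2 ^ d * Real.exp (-(q * n ^ (k - 1) / 2))) +
          ∑ X : Finset (Fin k × Fin n) with X.Nonempty ∧ X.card < D,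
            labelProb (labelWeight p q) {f | IsStuck d X f}))) := by
  have hw := labelWeight_nonneg hp hpq hq
  let E := (completeBalanced k n).edges
  have hn' : (0 : ℝ) < n := by exact_mod_cast hn
  let A1 : Set (EdgeOrdering k n) :=
    {ω | η * n ^ k ≤ ((E \ P.closure (initialSet ω m)).card : ℝ)}
  let bad : Set (EdgeOrdering k n) := {ω : EdgeOrdering k n | ¬ ∃ T : KGraph k (Fin k × Fin n),
      T.IsSpanningSubgraph (closureGraph P (randomGraph ω (hittingTime d ω))) ∧
        IsPartiteTree d T}
  let i0 : Fin k := ⟨0, by omega⟩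
  let B1 : Set (E → Fin 3) := {f | (E.filter (· ∈ labelSet f 0)).card ≤ m}
  let B2 : Set (E → Fin 3) := {f | ∀ x : Fin n, ∃ e ∈ labelSet f 0, (i0, x) ∈ e}
  let B3 : Fin k × Fin n → Set (E → Fin 3) := fun v =>
    {f | ((E.filter (fun e => v ∈ e)).filter (· ∈ labelSet f 1)).card ≤ d}
  have hcover : bad ⊆ A1 ∪ (bad \ A1) := by
    rw [Set.union_sdiff_self]; exact Set.subset_union_right
  refine (uniformProb_mono hcover).trans ((uniformProb_union_le _ _).trans (add_le_add ?_ ?_))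
  · have h1 := sum_card_sdiff_closure_initialSet_le P (M := E.card) (m := m)
      (by rw [card_edges]; exact hm)
    have hm' : (0 : ℝ) < m := by exact_mod_cast hm0
    have h2 := uniformProb_le_of_sum_le (Ω := EdgeOrdering k n)
      (fun ω => ((E \ P.closure (initialSet ω m)).card : ℝ)) (fun _ => Nat.cast_nonneg _)
      (t := η * n ^ k) (S := a * n * n ^ k / m) (by positivity) (by
        rw [div_mul_eq_mul_div, le_div_iff₀ hm', mul_comm]
        refine h1.trans (mul_le_mul_of_nonneg_right ?_ (Nat.cast_nonneg _))
        have h3 : (P.rank : ℝ) ≤ a * n := by exact_mod_cast hP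
        have h4 : (E.card : ℝ) = n ^ k := by exact_mod_cast card_edges
        rw [h4]
        gcongr) (by positivity)
    refine h2.trans (le_of_eq ?_)
    field_simp
  · have htransfer : uniformProb (bad \ A1) ≤ labelProb (labelWeight p q)
        (B1 ∪ (B2 ∪ ((⋃ v ∈ (Finset.univ : Finset (Fin k × Fin n)), B3 v) ∪
          ⋃ X ∈ Finset.univ.filter (fun X : Finset (Fin k × Fin n) => X.Nonempty ∧ X.card < D),
            {f | IsStuck d X f}))) := by
      refine uniformProb_le_labelProb hw (sum_labelWeight p q)
        (Classical.arbitrary (EdgeOrdering k n)) _ _ fun ω f hf hω => ?_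
      by_contra hcon
      simp only [Set.mem_union, not_or, Set.mem_iUnion, exists_prop, not_exists, not_and,
        Finset.mem_univ, Finset.mem_filter, true_and] at hcon
      obtain ⟨hB1, hB2, hB3, hB4⟩ := hcon
      refine hω.1 (exists_spanning_tree_of_labels hk hn hdn P ω f hf D m ?_ ?_ ?_ ?_ ?_)
      · have h1 : ((E \ P.closure (initialSet ω m)).card : ℝ) < η * n ^ k := not_le.1 hω.2
        have hdk : (0 : ℝ) < d := by exact_mod_cast hd
        have hD' : (0 : ℝ) < D := by exact_mod_cast hD
        have h2 : (d : ℝ) ^ k * (D + k * n) * ((E \ P.closure (initialSet ω m)).card : ℝ) <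
            D * n ^ k := by
          calc _ < (d : ℝ) ^ k * (D + k * n) * (η * n ^ k) := by gcongr
            _ = ((d : ℝ) ^ k * (D + k * n) * η) * n ^ k := by ring
            _ ≤ _ := by gcongr
        exact_mod_cast h2
      · have h1 : E.filter (· ∈ labelSet f 0) = labelSet f 0 := by
          rw [Finset.filter_mem_eq_inter]
          exact Finset.inter_eq_right.2 (labelSet_subset _ _)
        rw [← h1]
        exact not_le.1 hB1
      · intro hdeg
        refine hB2 fun x => ?_
        have h1 := hd.trans_le (hdeg (i0, x) (Finset.mem_univ _))
        obtain ⟨e, he⟩ := Finset.card_pos.1 h1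
        obtain ⟨he1, he2⟩ := Finset.mem_filter.1 he
        exact ⟨e, (Finset.mem_inter.1 he1).2, he2⟩
      · intro v _
        refine (not_le.1 (hB3 v)).le.trans (Finset.card_le_card fun e he => ?_)
        obtain ⟨he1, he2⟩ := Finset.mem_filter.1 he
        obtain ⟨he1, he3⟩ := Finset.mem_filter.1 he1
        exact Finset.mem_filter.2 ⟨Finset.mem_inter.2 ⟨he1, he2⟩, he3⟩
      · exact fun X hX1 hX2 => hB4 X ⟨hX1, hX2⟩
    refine htransfer.trans ((labelProb_union_le hw _ _).trans (add_le_add ?_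
      ((labelProb_union_le hw _ _).trans (add_le_add ?_
        ((labelProb_union_le hw _ _).trans (add_le_add ?_ (labelProb_biUnion_le hw _ _)))))))
    · have h1 := labelProb_card_le hw (sum_labelWeight p q) (subset_refl E) 0 m
      rw [sum_labelWeight_le_zero, card_edges] at h1
      exact_mod_cast h1
    · have h1 := labelProb_cover (E := E) (sum_labelWeight p q) 0
        (fun (x : Fin n) e => (i0, x) ∈ e) (n ^ (k - 1)) (card_edges_meeting i0)
      rw [sum_labelWeight_le_zero, Fintype.card_fin] at h1
      exact h1.le
    · refine (labelProb_biUnion_le hw _ _).trans ?_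
      have h1 : ∀ v, labelProb (labelWeight p q) (B3 v) ≤
          2 ^ d * Real.exp (-(q * n ^ (k - 1) / 2)) := by
        intro v
        have h2 := labelProb_card_le hw (sum_labelWeight p q)
          (Finset.filter_subset (fun e => v ∈ e) E) 1 d
        rw [sum_labelWeight_le_one, card_edges_containing] at h2
        exact_mod_cast h2
      refine (Finset.sum_le_sum fun v _ => h1 v).trans (le_of_eq ?_)
      rw [Finset.sum_const, Finset.card_univ, Fintype.card_prod, Fintype.card_fin,
        Fintype.card_fin, nsmul_eq_mul]
      push_cast
      ring

end failure

/-! ### Stuck sets are unlikely -/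

section stuck

variable {k n d : ℕ}

lemma choose_le_exp_mul_div_pow {N s : ℕ} (hs : 0 < s) :
    (N.choose s : ℝ) ≤ (Real.exp 1 * N / s) ^ s := by
  have hs' : (0 : ℝ) < s := by exact_mod_cast hs
  have h1 := Real.pow_div_factorial_le_exp (s : ℝ) hs'.le s
  have hf : (0 : ℝ) < s.factorial := by exact_mod_cast s.factorial_pos
  have h2 : ((s.factorial : ℝ))⁻¹ ≤ (Real.exp 1 / s) ^ s := by
    rw [div_pow, ← Real.exp_nat_mul, mul_one, le_div_iff₀ (by positivity), inv_mul_eq_div]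
    exact h1
  calc (N.choose s : ℝ) ≤ (N : ℝ) ^ s / s.factorial := Nat.choose_le_pow_div s N
    _ = (N : ℝ) ^ s * (s.factorial : ℝ)⁻¹ := div_eq_mul_inv _ _
    _ ≤ (N : ℝ) ^ s * (Real.exp 1 / s) ^ s := by gcongr
    _ = _ := by rw [← mul_pow]; congr 1; ring

/-- The expected number of stuck sets of size `s` decays geometrically in `s`. The factor
`(e k n / s) ^ s` for the choice of the set is beaten by the two requirements of being stuck: the
cover by edges with two vertices in the set contributes about `(s / n) ^ (s / 2)`, and the few edges
with label `0` about `n ^ (- 3 s / 4)`. -/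
lemma choose_mul_stuck_bound_le (hk : 0 < k) (hn : 0 < n) {κ δ p q : ℝ} (hκ : 0 < κ)
    (hκ2 : κ ^ 2 * (2 ^ k * 80) = 1) (hδk : (k : ℝ) * δ ≤ 1 / 15) (hδ0 : 0 ≤ δ)
    (hp : p = 3 / 4 * Real.log n / n ^ (k - 1)) (hq : q = 4 * Real.log n / n ^ (k - 1))
    {s : ℕ} (hs : 0 < s) (hsδ : (s : ℝ) ≤ δ * n) :
    ((k * n).choose s : ℝ) * (((κ * √(n / s)) ^ s)⁻¹ * (((1 / 15 : ℝ)) ^ (s * d))⁻¹ *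
      (Real.exp (q * (2 ^ k * n ^ k * (κ * √(n / s) * s / n) ^ 2)) *
        Real.exp (-((1 - 1 / 15) * p * (s * (n - s : ℝ) ^ (k - 1)))))) ≤
      (Real.exp 1 * k * 15 ^ d / κ * Real.exp (-(Real.log n / 10))) ^ s := by
  have hn' : (0 : ℝ) < n := by exact_mod_cast hn
  have hs' : (0 : ℝ) < s := by exact_mod_cast hs
  have hs1 : (1 : ℝ) ≤ s := by exact_mod_cast hs
  have hk1 : (1 : ℝ) ≤ k := by exact_mod_cast hk
  set L := Real.log n with hL
  have hL0 : 0 ≤ L := Real.log_nonneg (by exact_mod_cast hn)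
  have hM : (0 : ℝ) < (n : ℝ) ^ (k - 1) := by positivity
  have hnk : (n : ℝ) ^ k = n ^ (k - 1) * n := by
    rw [← pow_succ, Nat.sub_add_cancel hk]
  have hsq : √((n : ℝ) / s) ^ 2 = n / s := Real.sq_sqrt (by positivity)
  have hsq0 : 0 < √((n : ℝ) / s) := Real.sqrt_pos.2 (by positivity)
  have hδ1 : δ ≤ 1 := by nlinarith
  have e1 : q * (2 ^ k * n ^ k * (κ * √(n / s) * s / n) ^ 2) = L * s / 20 := by
    have h1 : (κ * √(n / s) * s / n) ^ 2 = κ ^ 2 * s / n := by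
      rw [div_pow, mul_pow, mul_pow, hsq]
      field_simp
    rw [h1, hq, hnk]
    have h2 : 4 * L / n ^ (k - 1) * (2 ^ k * (n ^ (k - 1) * n) * (κ ^ 2 * s / n)) =
        (κ ^ 2 * (2 ^ k * 80)) * (L * s / 20) := by
      field_simp
      ring
    rw [h2, hκ2, one_mul]
  have e2 : 49 / 75 * L * s ≤ (1 - 1 / 15) * p * (s * (n - s : ℝ) ^ (k - 1)) := by
    have h1 : (14 / 15 : ℝ) ≤ (1 - δ) ^ (k - 1) := by
      have h2 := one_add_mul_le_pow (a := -δ) (by linarith) (k - 1)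
      rw [← sub_eq_add_neg] at h2
      refine le_trans ?_ h2
      have h3 : ((k - 1 : ℕ) : ℝ) ≤ k := by exact_mod_cast Nat.sub_le k 1
      nlinarith
    have h2 : (1 - δ) ^ (k - 1) * (n : ℝ) ^ (k - 1) ≤ (n - s : ℝ) ^ (k - 1) := by
      rw [← mul_pow]
      refine pow_le_pow_left₀ (by nlinarith) (by linarith) _
    have h3 : (14 / 15 : ℝ) * n ^ (k - 1) ≤ (n - s : ℝ) ^ (k - 1) :=
      le_trans (by gcongr) h2
    have hp0 : 0 ≤ p := by rw [hp]; positivity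
    calc 49 / 75 * L * s = (1 - 1 / 15) * p * (s * (14 / 15 * n ^ (k - 1))) := by
          rw [hp]; field_simp; ring
      _ ≤ _ := by
          have : (0 : ℝ) ≤ 1 - 1 / 15 := by norm_num
          gcongr
  have e3 : Real.exp (q * (2 ^ k * n ^ k * (κ * √(n / s) * s / n) ^ 2)) *
      Real.exp (-((1 - 1 / 15) * p * (s * (n - s : ℝ) ^ (k - 1)))) ≤
      Real.exp (-(3 / 5 * L)) ^ s := by
    rw [← Real.exp_add, ← Real.exp_nat_mul]
    refine Real.exp_le_exp.2 ?_
    rw [e1]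
    have : 0 ≤ L * s := by positivity
    nlinarith
  have e4 : ((k * n : ℕ).choose s : ℝ) ≤ (Real.exp 1 * k * (n / s)) ^ s := by
    refine (choose_le_exp_mul_div_pow hs).trans (le_of_eq ?_)
    congr 1
    push_cast
    ring
  have e5 : (((1 / 15 : ℝ)) ^ (s * d))⁻¹ = (15 ^ d) ^ s := by
    rw [one_div, inv_pow, inv_inv, mul_comm, pow_mul]
  calc _ ≤ (Real.exp 1 * k * (n / s)) ^ s * (((κ * √(n / s)) ^ s)⁻¹ * (15 ^ d) ^ s *
        Real.exp (-(3 / 5 * L)) ^ s) := by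
        rw [e5]
        gcongr
    _ = (Real.exp 1 * k * (n / s) * ((κ * √(n / s))⁻¹ * 15 ^ d * Real.exp (-(3 / 5 * L)))) ^ s := by
        rw [← inv_pow, ← mul_pow, ← mul_pow, ← mul_pow]
    _ = (Real.exp 1 * k * 15 ^ d / κ * (√(n / s) * Real.exp (-(3 / 5 * L)))) ^ s := by
        congr 1
        have h1 : (n : ℝ) / s = √(n / s) * √(n / s) := by rw [← sq, hsq]
        rw [mul_inv]
        calc _ = Real.exp 1 * k * 15 ^ d / κ * ((n / s) * (√(n / s))⁻¹ *
              Real.exp (-(3 / 5 * L))) := by ring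
          _ = _ := by
            congr 2
            nth_rewrite 1 [h1]
            field_simp
    _ ≤ _ := by
        have h2 : √((n : ℝ) / s) ≤ Real.exp (L / 2) := by
          rw [Real.sqrt_le_left (Real.exp_pos _).le, ← Real.exp_nat_mul]
          have : ((2 : ℕ) : ℝ) * (L / 2) = L := by push_cast; ring
          rw [this, hL, Real.exp_log hn']
          exact div_le_self hn'.le hs1
        have h3 : √((n : ℝ) / s) * Real.exp (-(3 / 5 * L)) ≤ Real.exp (-(L / 10)) := by
          calc _ ≤ Real.exp (L / 2) * Real.exp (-(3 / 5 * L)) := by gcongr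
            _ = _ := by rw [← Real.exp_add]; congr 1; ring
        gcongr

lemma sum_labelProb_isStuck_le (hk : 0 < k) (hn : 0 < n) {κ δ p q x : ℝ} (hκ : 0 < κ)
    (hκ2 : κ ^ 2 * (2 ^ k * 80) = 1) (hδκ : δ ≤ κ ^ 2) (hδk : (k : ℝ) * δ ≤ 1 / 15) (hδ0 : 0 ≤ δ)
    (hp : p = 3 / 4 * Real.log n / n ^ (k - 1)) (hq : q = 4 * Real.log n / n ^ (k - 1))
    (hq1 : q ≤ 1) (hx : x = Real.exp 1 * k * 15 ^ d / κ * Real.exp (-(Real.log n / 10)))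
    (hx2 : x ≤ 1 / 2) {D : ℕ} (hD : ∀ s : ℕ, s < D → (s : ℝ) ≤ δ * n) :
    ∑ X : Finset (Fin k × Fin n) with X.Nonempty ∧ X.card < D,
      labelProb (labelWeight p q) {f | IsStuck d X f} ≤ 2 * x := by
  have hn' : (0 : ℝ) < n := by exact_mod_cast hn
  have hL0 : 0 ≤ Real.log n := Real.log_nonneg (by exact_mod_cast hn)
  have hp0 : 0 ≤ p := by rw [hp]; positivity
  have hpq : p ≤ q := by
    rw [hp, hq]
    gcongr
    norm_num
  have hx0 : 0 ≤ x := by rw [hx]; positivity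
  have hκ1 : κ ^ 2 ≤ 1 := by
    have : (1 : ℝ) ≤ 2 ^ k := one_le_pow₀ (by norm_num)
    nlinarith [sq_nonneg κ]
  let b : ℕ → ℝ := fun s => ((κ * √(n / s)) ^ s)⁻¹ * (((1 / 15 : ℝ)) ^ (s * d))⁻¹ *
      (Real.exp (q * (2 ^ k * n ^ k * (κ * √(n / s) * s / n) ^ 2)) *
        Real.exp (-((1 - 1 / 15) * p * (s * (n - s : ℝ) ^ (k - 1)))))
  let F : ℕ → ℝ := fun s => if 0 < s ∧ s < D then b s else 0
  have hterm : ∀ X : Finset (Fin k × Fin n),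
      (if X.Nonempty ∧ X.card < D then labelProb (labelWeight p q) {f | IsStuck d X f} else 0) ≤
        F X.card := by
    intro X
    by_cases h : X.Nonempty ∧ X.card < D
    · have h' : 0 < X.card ∧ X.card < D := ⟨h.1.card_pos, h.2⟩
      simp only [F]
      rw [if_pos h, if_pos h']
      have hs' : (0 : ℝ) < X.card := by exact_mod_cast h'.1
      have hsδ := hD _ h.2
      have hsn : (X.card : ℝ) ≤ κ ^ 2 * n := hsδ.trans (by gcongr)
      have hsq : √((n : ℝ) / X.card) ^ 2 = n / X.card := Real.sq_sqrt (by positivity)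
      refine labelProb_isStuck_le hn hp0 hpq hq1 h.1 ?_ ?_ (by norm_num) (by norm_num)
      · have h1 : (1 : ℝ) ≤ (κ * √(n / X.card)) ^ 2 := by
          rw [mul_pow, hsq, ← mul_div_assoc, one_le_div hs']
          exact hsn
        exact (one_le_sq_iff₀ (by positivity)).1 h1
      · have h1 : (κ * √(n / X.card) * X.card) ^ 2 ≤ (n : ℝ) ^ 2 := by
          rw [mul_pow, mul_pow, hsq]
          have h2 : κ ^ 2 * ((n : ℝ) / X.card) * X.card ^ 2 = κ ^ 2 * (n * X.card) := by
            field_simp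
          have h3 : (X.card : ℝ) ≤ n := hsn.trans (mul_le_of_le_one_left hn'.le hκ1)
          rw [h2, sq (n : ℝ)]
          calc κ ^ 2 * (n * X.card) ≤ 1 * (n * n : ℝ) := by gcongr
            _ = _ := one_mul _
        exact (sq_le_sq₀ (by positivity) hn'.le).1 h1
    · rw [if_neg h]
      simp only [F]
      split_ifs
      · positivity
      · exact le_rfl
  rw [Finset.sum_filter]
  refine (Finset.sum_le_sum fun X _ => hterm X).trans ?_
  rw [← Finset.powerset_univ, Finset.sum_powerset_apply_card, Finset.card_univ, Fintype.card_prod,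
    Fintype.card_fin, Fintype.card_fin]
  have hF : ∀ s : ℕ, (k * n).choose s • F s ≤ if s = 0 then 0 else x ^ s := by
    intro s
    simp only [F]
    by_cases h : 0 < s ∧ s < D
    · rw [if_pos h, if_neg h.1.ne', nsmul_eq_mul, hx]
      exact choose_mul_stuck_bound_le hk hn hκ hκ2 hδk hδ0 hp hq h.1 (hD s h.2)
    · rw [if_neg h, smul_zero]
      split_ifs <;> positivity
  refine (Finset.sum_le_sum fun s _ => hF s).trans ?_
  rw [Finset.sum_range_succ']
  simp only [Nat.add_eq_zero_iff, one_ne_zero, and_false, if_false, if_true, add_zero]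
  have hx1 : x < 1 := by linarith
  calc ∑ s ∈ Finset.range (k * n), x ^ (s + 1) = x * ∑ s ∈ Finset.range (k * n), x ^ s := by
        rw [Finset.mul_sum]; exact Finset.sum_congr rfl fun s _ => pow_succ' x s
    _ ≤ x * (1 - x)⁻¹ := by
        gcongr
        rw [← tsum_geometric_of_lt_one hx0 hx1]
        exact (summable_geometric_of_lt_one hx0 hx1).sum_le_tsum _ fun _ _ => by positivity
    _ ≤ x * 2 := by
        gcongr
        rw [inv_le_comm₀ (by linarith) (by norm_num)]
        linarith
    _ = 2 * x := mul_comm _ _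

end stuck

/-! ### Asymptotics -/

section asymptotics

/-- Below the covering threshold the expected number of uncovered vertices of a class is at least
`exp (log n / 16)`, which makes it unlikely that the class is covered. -/
lemma cover_bound_le {n N : ℕ} (hn : 0 < n) {p : ℝ} (hp0 : 0 ≤ p) (hp1 : p ≤ 1 / 5)
    (hpN : p * N = 3 / 4 * Real.log n) :
    (1 - (1 - p) ^ N) ^ n ≤ Real.exp (-Real.exp (Real.log n / 16)) := by
  have hn' : (0 : ℝ) < n := by exact_mod_cast hn
  have h1p : 0 < 1 - p := by linarith
  have h1 : Real.exp (-(5 / 4 * p)) ≤ 1 - p := by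
    rw [← Real.le_log_iff_exp_le h1p]
    refine le_trans ?_ (Real.one_sub_inv_le_log_of_pos h1p)
    have h2 : (1 - p)⁻¹ ≤ 1 + 5 / 4 * p := by
      rw [inv_le_iff_one_le_mul₀ h1p]
      nlinarith
    linarith
  have h2 : Real.exp (-(15 / 16 * Real.log n)) ≤ (1 - p) ^ N := by
    calc Real.exp (-(15 / 16 * Real.log n)) = Real.exp (-(5 / 4 * p)) ^ N := by
          rw [← Real.exp_nat_mul]
          congr 1
          linear_combination (5 / 4) * hpN
      _ ≤ _ := by gcongr
  have h3 : (1 - p) ^ N ≤ 1 := pow_le_one₀ h1p.le (by linarith)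
  calc (1 - (1 - p) ^ N) ^ n ≤ (Real.exp (-Real.exp (-(15 / 16 * Real.log n)))) ^ n := by
        refine pow_le_pow_left₀ (by linarith) ?_ _
        have := Real.add_one_le_exp (-Real.exp (-(15 / 16 * Real.log n)))
        linarith
    _ = _ := by
        rw [← Real.exp_nat_mul]
        congr 1
        rw [mul_neg]
        congr 1
        nth_rewrite 1 [← Real.exp_log hn']
        rw [← Real.exp_add]
        congr 1
        ring

/-- The failure probability is at most a function of `log n` that tends to zero. -/
lemma exists_uniformProb_no_spanning_tree_le {a d k : ℕ} (hd : 0 < d) (hk : 2 ≤ k)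
    (P : (n : ℕ) → Polymatroid (completeBalanced k n).edges)
    (hP : ∀ n : ℕ, (P n).rank ≤ (a : ℤ) * (n : ℤ)) :
    ∃ c₁ c₂ c₃ : ℝ, ∀ᶠ n : ℕ in atTop,
      uniformProb {ω : EdgeOrdering k n | ¬ ∃ T : KGraph k (Fin k × Fin n),
        T.IsSpanningSubgraph (closureGraph (P n) (randomGraph ω (hittingTime d ω))) ∧
          IsPartiteTree d T} ≤
        c₁ / Real.log n + (Real.exp (-(Real.log n / 8)) +
          (Real.exp (-Real.exp (Real.log n / 16)) + (c₂ * Real.exp (-Real.log n) +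
            c₃ * Real.exp (-(Real.log n / 10))))) := by
  have hk0 : (0 : ℝ) < k := by exact_mod_cast (by omega : 0 < k)
  have hd0 : (0 : ℝ) < d := by exact_mod_cast hd
  set κ : ℝ := √(1 / (2 ^ k * 80)) with hκdef
  have hκ : 0 < κ := Real.sqrt_pos.2 (by positivity)
  have hκsq : κ ^ 2 = 1 / (2 ^ k * 80) := Real.sq_sqrt (by positivity)
  have hκ2 : κ ^ 2 * (2 ^ k * 80) = 1 := by rw [hκsq]; field_simp
  set δ : ℝ := min (κ ^ 2) (1 / (15 * k)) with hδ
  have hδ0 : 0 < δ := lt_min (by positivity) (by positivity)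
  have hδκ : δ ≤ κ ^ 2 := min_le_left _ _
  have hδk : (k : ℝ) * δ ≤ 1 / 15 := by
    calc (k : ℝ) * δ ≤ k * (1 / (15 * k)) := by gcongr; exact min_le_right _ _
      _ = 1 / 15 := by field_simp
  have hδ1 : δ ≤ 1 := by
    have : (1 : ℝ) ≤ k := by exact_mod_cast (by omega : 1 ≤ k)
    nlinarith
  set η : ℝ := δ / (d ^ k * (1 + k)) with hη
  have hη0 : 0 < η := by positivity
  set K : ℝ := Real.exp 1 * k * 15 ^ d / κ with hK
  have hlog : Tendsto (fun n : ℕ => Real.log n) atTop atTop :=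
    Real.tendsto_log_atTop.comp tendsto_natCast_atTop_atTop
  have hsmall : ∀ᶠ n : ℕ in atTop, 4 * Real.log n ≤ n := by
    have h1 := (Real.isLittleO_log_id_atTop.bound (by norm_num : (0 : ℝ) < 1 / 4))
    filter_upwards [tendsto_natCast_atTop_atTop.eventually h1, eventually_ge_atTop 1] with n hn h1n
    rw [Real.norm_of_nonneg (Real.log_nonneg (by exact_mod_cast h1n))] at hn
    simp only [id, Real.norm_natCast] at hn
    linarith
  have hxsmall : ∀ᶠ n : ℕ in atTop, K * Real.exp (-(Real.log n / 10)) ≤ 1 / 2 := by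
    have h1 : Tendsto (fun n : ℕ => K * Real.exp (-(Real.log n / 10))) atTop (𝓝 (K * 0)) :=
      (Real.tendsto_exp_neg_atTop_nhds_zero.comp
        (hlog.atTop_div_const (by norm_num))).const_mul K
    rw [mul_zero] at h1
    exact h1.eventually_le_const (by norm_num)
  refine ⟨8 * a / η, k * 2 ^ d, 2 * K, ?_⟩
  filter_upwards [hsmall, hxsmall, hlog.eventually_ge_atTop 8, eventually_ge_atTop d] with
    n h4 hx hL hdn
  have hn : 0 < n := hd.trans_le hdn
  have hn' : (0 : ℝ) < n := by exact_mod_cast hn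
  have hn1 : (1 : ℝ) ≤ n := by exact_mod_cast hn
  set L := Real.log n with hLdef
  have hL0 : 0 < L := by linarith
  have hM0 : (0 : ℝ) < (n : ℝ) ^ (k - 1) := by positivity
  have hM : (n : ℝ) ≤ n ^ (k - 1) := le_self_pow₀ hn1 (by omega)
  have hnk : (n : ℝ) ^ k = n ^ (k - 1) * n := by
    rw [← pow_succ, Nat.sub_add_cancel (by omega)]
  set p : ℝ := 3 / 4 * L / n ^ (k - 1) with hp
  set q : ℝ := 4 * L / n ^ (k - 1) with hq
  have hp0 : 0 ≤ p := by positivity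
  have hpq : p ≤ q := by rw [hp, hq]; gcongr; norm_num
  have hq1 : q ≤ 1 := by rw [hq, div_le_one hM0]; linarith
  have hp1 : p ≤ 1 / 5 := by
    have : p = 3 / 16 * q := by rw [hp, hq]; ring
    linarith
  have hpM : p * n ^ (k - 1) = 3 / 4 * L := by rw [hp]; field_simp
  have hqM : q * n ^ (k - 1) = 4 * L := by rw [hq]; field_simp
  set m : ℕ := ⌊(n : ℝ) * L / 4⌋₊ with hm
  have hmle : (m : ℝ) ≤ n * L / 4 := Nat.floor_le (by positivity)
  have hmge : n * L / 8 ≤ (m : ℝ) := by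
    have := Nat.sub_one_lt_floor ((n : ℝ) * L / 4)
    rw [← hm] at this
    nlinarith
  have hm0 : 0 < m := by
    have : (0 : ℝ) < m := lt_of_lt_of_le (by positivity) hmge
    exact_mod_cast this
  have hmk : m ≤ n ^ k := by
    have : (m : ℝ) ≤ n ^ k := by
      rw [hnk]
      nlinarith
    exact_mod_cast this
  set D : ℕ := ⌈δ * n⌉₊ with hD
  have hDge : δ * n ≤ D := Nat.le_ceil _
  have hD0 : 0 < D := Nat.ceil_pos.2 (by positivity)
  have hDn : (D : ℝ) ≤ n := by
    have : D ≤ n := Nat.ceil_le.2 (mul_le_of_le_one_left hn'.le hδ1)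
    exact_mod_cast this
  have hηD : (d : ℝ) ^ k * (D + k * n) * η ≤ D := by
    calc (d : ℝ) ^ k * (D + k * n) * η ≤ (d : ℝ) ^ k * (n + k * n) * η := by gcongr
      _ = δ * n := by rw [hη]; field_simp
      _ ≤ D := hDge
  refine (uniformProb_no_spanning_tree_le hk hn hd hdn (P n) (hP n) hp0 hpq hq1 hη0 hD0 hηD hm0
    hmk).trans ?_
  refine add_le_add ?_ (add_le_add ?_ (add_le_add ?_ (add_le_add ?_ ?_)))
  · calc (a : ℝ) * n / (m * η) ≤ a * n / (n * L / 8 * η) := by gcongr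
      _ = 8 * a / η / L := by field_simp
  · have h2 : (2 : ℝ) ^ m ≤ Real.exp (n * L / 4) := by
      calc (2 : ℝ) ^ m ≤ Real.exp 1 ^ m := by
            gcongr
            have := Real.add_one_le_exp (1 : ℝ)
            linarith
        _ = Real.exp m := by rw [← Real.exp_nat_mul, mul_one]
        _ ≤ _ := Real.exp_le_exp.2 hmle
    have h3 : p * n ^ k = 3 / 4 * L * n := by rw [hnk, ← mul_assoc, hpM]
    calc 2 ^ m * Real.exp (-(p * n ^ k / 2)) ≤
          Real.exp (n * L / 4) * Real.exp (-(p * n ^ k / 2)) := by gcongr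
      _ = Real.exp (-(n * L / 8)) := by rw [← Real.exp_add, h3]; congr 1; ring
      _ ≤ _ := by
        refine Real.exp_le_exp.2 (neg_le_neg ?_)
        have : 1 * L ≤ n * L := by gcongr
        linarith
  · exact cover_bound_le hn hp0 hp1 (by push_cast; exact hpM)
  · refine le_of_eq ?_
    have h2 : (n : ℝ) * Real.exp (-(q * n ^ (k - 1) / 2)) = Real.exp (-L) := by
      nth_rewrite 1 [← Real.exp_log hn']
      rw [← Real.exp_add, hqM, ← hLdef]
      congr 1
      ring
    rw [← h2]
    ring
  · have h2 := sum_labelProb_isStuck_le (d := d) (by omega : 0 < k) hn hκ hκ2 hδκ hδk hδ0.le hp hq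
      hq1 (x := K * Real.exp (-(L / 10))) (by rw [hK]) hx (D := D) (fun s hs => (Nat.lt_ceil.1 hs).le)
    exact h2.trans (le_of_eq (mul_assoc _ _ _).symm)

lemma tendsto_uniformProb_no_spanning_tree {a d k : ℕ} (hd : 0 < d) (hk : 2 ≤ k)
    (P : (n : ℕ) → Polymatroid (completeBalanced k n).edges)
    (hP : ∀ n : ℕ, (P n).rank ≤ (a : ℤ) * (n : ℤ)) :
    Tendsto (fun n : ℕ => uniformProb {ω : EdgeOrdering k n | ¬ ∃ T : KGraph k (Fin k × Fin n),
        T.IsSpanningSubgraph (closureGraph (P n) (randomGraph ω (hittingTime d ω))) ∧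
          IsPartiteTree d T}) atTop (𝓝 0) := by
  obtain ⟨c₁, c₂, c₃, h⟩ := exists_uniformProb_no_spanning_tree_le hd hk P hP
  have hlog : Tendsto (fun n : ℕ => Real.log n) atTop atTop :=
    Real.tendsto_log_atTop.comp tendsto_natCast_atTop_atTop
  have hexp : ∀ {u : ℝ → ℝ}, Tendsto u atTop atTop →
      Tendsto (fun x => Real.exp (-(u x))) atTop (𝓝 0) := fun hu =>
    Real.tendsto_exp_neg_atTop_nhds_zero.comp hu
  have hlim : Tendsto (fun x : ℝ => c₁ / x + (Real.exp (-(x / 8)) +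
      (Real.exp (-Real.exp (x / 16)) + (c₂ * Real.exp (-x) + c₃ * Real.exp (-(x / 10))))))
      atTop (𝓝 (0 + (0 + (0 + (c₂ * 0 + c₃ * 0))))) :=
    (tendsto_const_nhds.div_atTop tendsto_id).add
      ((hexp (tendsto_id.atTop_div_const (by norm_num))).add
        ((hexp (Real.tendsto_exp_atTop.comp (tendsto_id.atTop_div_const (by norm_num)))).add
          (((hexp tendsto_id).const_mul c₂).add
            ((hexp (tendsto_id.atTop_div_const (by norm_num))).const_mul c₃))))
  simp only [mul_zero, add_zero] at hlim
  exact squeeze_zero' (Eventually.of_forall fun n => uniformProb_nonneg _) h (hlim.comp hlog)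

end asymptotics

theorem mainTheorem4 (a d k : ℕ) (ha : 0 < a) (hd : 0 < d) (hk : 0 < k) (hkd : k = 1 → d = 1)
    (P : (n : ℕ) → Polymatroid (completeBalanced k n).edges)
    (hP : ∀ n : ℕ, (P n).rank ≤ (a : ℤ) * (n : ℤ)) :
    Tendsto
      (fun n : ℕ => orderingProb k n (fun ω =>
        ∃ T : KGraph k (Fin k × Fin n),
          T.IsSpanningSubgraph (closureGraph (P n) (randomGraph ω (hittingTime d ω))) ∧
            IsPartiteTree d T))
      atTop (𝓝 1) := by
  have hprob : ∀ n (A : EdgeOrdering k n → Prop),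
      orderingProb k n A = ENNReal.ofReal (1 - uniformProb {ω | ¬ A ω}) := by
    intro n A
    have h1 := uniformProb_compl {ω | A ω}
    have h2 : {ω | ¬ A ω} = {ω | A ω}ᶜ := rfl
    rw [orderingProb, uniformOfFintype_toOuterMeasure, h2, h1, sub_sub_cancel]
  simp_rw [hprob]
  have hlim : Tendsto (fun n : ℕ => uniformProb {ω : EdgeOrdering k n |
      ¬ ∃ T : KGraph k (Fin k × Fin n),
        T.IsSpanningSubgraph (closureGraph (P n) (randomGraph ω (hittingTime d ω))) ∧
          IsPartiteTree d T}) atTop (𝓝 0) := by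
    rcases (Nat.succ_le_of_lt hk).eq_or_lt with h1 | h2
    · obtain rfl : k = 1 := h1.symm
      obtain rfl := hkd rfl
      refine tendsto_const_nhds.congr' ?_
      filter_upwards [eventually_gt_atTop 0] with n hn
      have : {ω : EdgeOrdering 1 n | ¬ ∃ T : KGraph 1 (Fin 1 × Fin n),
        T.IsSpanningSubgraph (closureGraph (P n) (randomGraph ω (hittingTime 1 ω))) ∧
          IsPartiteTree 1 T} = ∅ := by
        ext ω
        simpa using exists_spanning_tree_of_uniformity_one hn (P n) ω
      rw [this]
      simp [uniformProb]
    · exact tendsto_uniformProb_no_spanning_tree hd h2 P hP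
  have := ENNReal.tendsto_ofReal (hlim.const_sub 1)
  simpa using this
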